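/- Let $n,m\ge 0$ be integers and let $H$ be the hyperplane line bundle over the complex projective space $\mathbb{P}^n(\mathbb{C})$, so that the holomorphic sections of $H^m$ are the holomorphic functions $F$ on $\mathbb{C}^{n+1}\setminus\{0\}$ with $F(cw)=c^mF(w)$ for all $c\in\mathbb{C}\setminus\{0\}$. Use the inhomogeneous coordinates $z\mapsto[(1,z)]$, $z\in\mathbb{C}^n$, in which the section $F$ becomes the function $f(z)=F(1,z)$ and the square integrable sections of $H^m$ form the Hilbert space $L^2(\mathbb{C}^n,\nu_m)$, where $$d\nu_m(z)=\frac{(n+m)!}{\pi^n\,m!}\,\frac{dz}{(1+|z_1|^2+\dots+|z_n|^2)^{n+m+1}} .$$ The weighted Bergman space $\mathcal{A}^2_m(\mathbb{P}^n(\mathbb{C}))$ is the finite-dimensional subspace of $L^2(\mathbb{C}^n,\nu_m)$ given by the holomorphic sections of $H^m$, and $B_m$ is the orthogonal projection of $L^2(\mathbb{C}^n,\nu_m)$ onto it. The Toeplitz operator with symbol $a\in L^\infty(\mathbb{C}^n)=L^\infty(\mathbb{P}^n(\mathbb{C}))$ is the operator $T_a f=B_m(af)$ on $\mathcal{A}^2_m(\mathbb{P}^n(\mathbb{C}))$.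 The group $\mathrm{U}(n)$ acts unitarily on $\mathcal{A}^2_m(\mathbb{P}^n(\mathbb{C}))$ by $(A\cdot f)(z)=f(A^{-1}z)$. Let $K$ be a closed subgroup of $\mathrm{U}(n)$. Let $\mathcal{A}^K$ be the set of symbols $a\in L^\infty(\mathbb{C}^n)$ such that, for every $k\in K$, $a(kz)=a(z)$ for almost every $z$, and let $\mathcal{T}^{(m)}(\mathcal{A}^K)$ be the $C^*$-algebra of operators on $\mathcal{A}^2_m(\mathbb{P}^n(\mathbb{C}))$ generated by the Toeplitz operators $T_a$ with $a\in\mathcal{A}^K$. An isotypic decomposition of the $K$-module $\mathcal{A}^2_m(\mathbb{P}^n(\mathbb{C}))$ is a direct sum decomposition $$\mathcal{A}^2_m(\mathbb{P}^n(\mathbb{C}))=\bigoplus_{j=1}^{l}V_j$$ for which there are mutually inequivalent irreducible $K$-modules $U_1,\dots,U_l$ such that each $V_j$ is the direct sum of $r_j\ge 1$ irreducible $K$-submodules isomorphic to $U_j$; the number $r_j$ is the multiplicity of $U_j$. **Theorem.** The $K$-module $\mathcal{A}^2_m(\mathbb{P}^n(\mathbb{C}))$ has an isotypic decomposition, and for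 every isotypic decomposition of it, with multiplicities $r_1,\dots,r_l$, $$\mathcal{T}^{(m)}(\mathcal{A}^K)\;\cong\;\bigoplus_{j=1}^{l}M_{r_j}(\mathbb{C})$$ as $C^*$-algebras (by an isometric $*$-isomorphism). In particular, the following are equivalent: 1. the $C^*$-algebra $\mathcal{T}^{(m)}(\mathcal{A}^K)$ is commutative; 2. the representation of $K$ on $\mathcal{A}^2_m(\mathbb{P}^n(\mathbb{C}))$ is multiplicity-free, that is, $r_j=1$ for all $j$. -/

import Mathlib

open MeasureTheory Filter Topology
open scoped ENNReal Matrix.Norms.L2Operator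

namespace ProjBergman

section EntireFunctions

theorem entire_eq_zero_of_growth (m : ℕ) : ∀ (g : ℂ → ℂ), Differentiable ℂ g →
    ∀ C : ℝ, (∀ t, ‖g t‖ ≤ C * (1 + ‖t‖) ^ m) →
    ∀ s : Finset ℂ, m < s.card → (∀ t ∈ s, g t = 0) → ∀ t, g t = 0 := by
  induction m with
  | zero =>
    intro g hg C hC s hs h0 t
    obtain ⟨a, ha⟩ := Finset.card_pos.mp hs
    have hb : Bornology.IsBounded (Set.range g) := by
      rw [isBounded_iff_forall_norm_le]
      refine ⟨C, ?_⟩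
      rintro _ ⟨t, rfl⟩
      simpa using hC t
    rw [hg.apply_eq_apply_of_bounded hb t a, h0 a ha]
  | succ m ih =>
    intro g hg C hC s hs h0 t
    obtain ⟨a, ha⟩ := Finset.card_pos.mp (by omega : 0 < s.card)
    have hC0 : 0 ≤ C := by simpa using (norm_nonneg _).trans (hC 0)
    have hdiff : Differentiable ℂ (dslope g a) := by
      rw [← differentiableOn_univ]
      exact (Complex.differentiableOn_dslope univ_mem).mpr hg.differentiableOn
    obtain ⟨D, hD⟩ := (isCompact_closedBall a 1).exists_bound_of_continuousOn
      hdiff.continuous.continuousOn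
    have hD0 : 0 ≤ D := (norm_nonneg _).trans (hD a (by simp))
    have key : ∀ t, (t - a) * dslope g a t = g t := fun t => by
      have := sub_smul_dslope g a t
      rw [h0 a ha, sub_zero] at this
      simpa using this
    have hbound : ∀ t, ‖dslope g a t‖ ≤ (C * (2 + ‖a‖) + D) * (1 + ‖t‖) ^ m := by
      intro t
      have h1 : 1 ≤ (1 + ‖t‖) ^ m := one_le_pow₀ (by linarith [norm_nonneg t])
      have hE : 0 ≤ C * (2 + ‖a‖) := by positivity
      by_cases ht : ‖t - a‖ ≤ 1
      · have := hD t (by simpa [dist_eq_norm] using ht)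
        nlinarith
      · push Not at ht
        have h2 := hC t
        rw [← key t, norm_mul] at h2
        have h3 : 1 + ‖t‖ ≤ (2 + ‖a‖) * ‖t - a‖ := by
          have := norm_add_le (t - a) a
          rw [sub_add_cancel] at this
          nlinarith [norm_nonneg a]
        have h4 : ‖t - a‖ * ‖dslope g a t‖ ≤ ‖t - a‖ * (C * (2 + ‖a‖) * (1 + ‖t‖) ^ m) := by
          calc _ ≤ C * (1 + ‖t‖) ^ (m + 1) := h2
            _ = C * (1 + ‖t‖) ^ m * (1 + ‖t‖) := by ring
            _ ≤ C * (1 + ‖t‖) ^ m * ((2 + ‖a‖) * ‖t - a‖) := by gcongr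
            _ = _ := by ring
        have h5 := le_of_mul_le_mul_left h4 (by linarith)
        nlinarith
    have hz := ih (dslope g a) hdiff _ hbound (s.erase a)
      (by rw [Finset.card_erase_of_mem ha]; omega)
      (fun t ht => by
        have := key t
        rw [h0 t (Finset.mem_of_mem_erase ht)] at this
        exact (mul_eq_zero.mp this).resolve_left (sub_ne_zero.mpr (Finset.ne_of_mem_erase ht)))
    rw [← key t, hz t, mul_zero]

end EntireFunctions

/-! ### Holomorphic sections of the powers of the hyperplane bundle -/

/-- `ℂⁿ` with its Hermitian norm `‖z‖² = |z₁|² + ⋯ + |zₙ|²`. -/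
abbrev Cn (n : ℕ) : Type := EuclideanSpace ℂ (Fin n)

/-- The inverse `z ↦ (1, z₁, …, zₙ)` of the inhomogeneous coordinates on the open set
`U₀ = {[w] | w₀ ≠ 0}` of the projective space, lifted to `ℂⁿ⁺¹`. Its image has null complement. -/
def chart {n : ℕ} (z : Cn n) : Cn (n + 1) := WithLp.toLp 2 (Fin.cons 1 z.ofLp)

/-- The holomorphic sections of `H^m`, the `m`-th power of the hyperplane bundle over the
projective space `ℙⁿ(ℂ)`: these are the holomorphic functions on `ℂⁿ⁺¹ ∖ {0}` that are homogeneous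
of degree `m` (the value at the origin is irrelevant). If `H^m` is written as the set of classes
`[A, λ]` with `A ∈ U(n+1)`, the section with homogeneous function `F` is
`[A e₁] ↦ [A, F (A e₁)]`. -/
def IsHolomorphicSection (n m : ℕ) (F : Cn (n + 1) → ℂ) : Prop :=
  DifferentiableOn ℂ F {0}ᶜ ∧ ∀ c : ℂ, c ≠ 0 → ∀ w, w ≠ 0 → F (c • w) = c ^ m * F w

theorem norm_chart_sq {n : ℕ} (z : Cn n) : ‖chart z‖ ^ 2 = 1 + ‖z‖ ^ 2 := by
  rw [EuclideanSpace.norm_sq_eq, EuclideanSpace.norm_sq_eq, Fin.sum_univ_succ]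
  simp [chart]

theorem chart_ne_zero {n : ℕ} (z : Cn n) : chart z ≠ 0 := by
  intro h
  have := norm_chart_sq z
  rw [h] at this
  simp at this
  nlinarith [sq_nonneg ‖z‖]

theorem differentiable_chart {n : ℕ} : Differentiable ℂ (chart (n := n)) := by
  rw [differentiable_euclidean]
  intro i
  refine Fin.cases ?_ (fun j => ?_) i
  · simp [chart]
  · simp only [chart, Fin.cons_succ]
    fun_prop

theorem IsHolomorphicSection.bound {n m : ℕ} {F : Cn (n + 1) → ℂ}
    (hF : IsHolomorphicSection n m F) : ∃ C : ℝ, ∀ w, w ≠ 0 → ‖F w‖ ≤ C * ‖w‖ ^ m := by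
  obtain ⟨C, hC⟩ := (isCompact_sphere (0 : Cn (n + 1)) 1).exists_bound_of_continuousOn
    (hF.1.continuousOn.mono (fun w hw => by
      rintro rfl
      simp at hw))
  refine ⟨C, fun w hw => ?_⟩
  have hw' : (‖w‖ : ℂ) ≠ 0 := by simpa using hw
  have h1 : F w = (‖w‖ : ℂ) ^ m * F ((‖w‖ : ℂ)⁻¹ • w) := by
    rw [← hF.2 _ hw' _ (smul_ne_zero (inv_ne_zero hw') hw), smul_smul, mul_inv_cancel₀ hw',
      one_smul]
  rw [h1, norm_mul, norm_pow, Complex.norm_real, norm_norm, mul_comm]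
  gcongr
  apply hC
  simp [norm_smul, hw]

/-- The holomorphic sections of `H^m` in the trivialization of `H^m` over `U₀`, in which the section
with homogeneous function `F` becomes `F (w) / w₀ ^ m = F (1, z)`. -/
noncomputable def sections (n m : ℕ) : Submodule ℂ (Cn n → ℂ) where
  carrier := {f | ∃ F, IsHolomorphicSection n m F ∧ ∀ z, f z = F (chart z)}
  add_mem' := by
    rintro f g ⟨F, hF, hf⟩ ⟨G, hG, hg⟩
    exact ⟨F + G, ⟨hF.1.add hG.1, fun c hc w hw => by
      simp [hF.2 c hc w hw, hG.2 c hc w hw, mul_add]⟩, fun z => by simp [hf, hg]⟩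
  zero_mem' := ⟨0, ⟨differentiableOn_const 0, by simp⟩, by simp⟩
  smul_mem' := by
    rintro a f ⟨F, hF, hf⟩
    exact ⟨a • F, ⟨hF.1.const_smul a, fun c hc w hw => by
      simp [hF.2 c hc w hw, mul_left_comm]⟩, fun z => by simp [hf]⟩

theorem sections_differentiable {n m : ℕ} {f : Cn n → ℂ} (hf : f ∈ sections n m) :
    Differentiable ℂ f := by
  obtain ⟨F, hF, h⟩ := hf
  obtain rfl : f = F ∘ chart := funext h
  intro z
  exact ((hF.1 _ (chart_ne_zero z)).differentiableAt
    (isOpen_compl_singleton.mem_nhds (chart_ne_zero z))).comp z (differentiable_chart z)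

theorem sections_bound {n m : ℕ} {f : Cn n → ℂ} (hf : f ∈ sections n m) :
    ∃ C : ℝ, ∀ z, ‖f z‖ ≤ C * ‖chart z‖ ^ m := by
  obtain ⟨F, hF, h⟩ := hf
  obtain ⟨C, hC⟩ := hF.bound
  exact ⟨C, fun z => h z ▸ hC _ (chart_ne_zero z)⟩

/-- Evaluation on the grid `{0, …, m}ⁿ`; it only serves to prove that there are
finitely many independent sections. -/
noncomputable def gridEval (n m : ℕ) : sections n m →ₗ[ℂ] ((Fin n → Fin (m + 1)) → ℂ) where
  toFun f p := f.1 (WithLp.toLp 2 fun i => ((p i : ℕ) : ℂ))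
  map_add' _ _ := rfl
  map_smul' _ _ := rfl

theorem gridEval_injective (n m : ℕ) : Function.Injective (gridEval n m) := by
  rw [← LinearMap.ker_eq_bot, LinearMap.ker_eq_bot']
  rintro ⟨f, hf⟩ h0
  obtain ⟨C, hC⟩ := sections_bound hf
  have hd := sections_differentiable hf
  have hC0 : 0 ≤ C := by
    have h1 := (norm_nonneg _).trans (hC 0)
    have h2 : 0 < ‖chart (0 : Cn n)‖ ^ m := pow_pos (norm_pos_iff.mpr (chart_ne_zero _)) _
    exact nonneg_of_mul_nonneg_left h1 h2
  have main : ∀ S : Finset (Fin n), ∀ z : Fin n → ℂ,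
      (∀ i, i ∉ S → ∃ p : Fin (m + 1), z i = ((p : ℕ) : ℂ)) → f (WithLp.toLp 2 z) = 0 := by
    intro S
    induction S using Finset.induction_on with
    | empty =>
      intro z hz
      choose p hp using fun i => hz i (Finset.notMem_empty i)
      have := congrFun h0 p
      obtain rfl : z = fun i => ((p i : ℕ) : ℂ) := funext hp
      exact this
    | insert i S hi ih =>
      intro z hz
      let γ : ℂ → Cn n := fun t => WithLp.toLp 2 (Function.update z i t)
      have hγ : Differentiable ℂ γ := by
        rw [differentiable_euclidean]
        intro j
        by_cases hj : j = i
        · subst hj; simp [γ]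
        · simp [γ, hj]
      have hγb : ∀ t, ‖chart (γ t)‖ ≤ (1 + ‖chart (γ 0)‖) * (1 + ‖t‖) := by
        intro t
        have h1 : γ t = γ 0 + EuclideanSpace.single i t := by
          ext j
          by_cases hj : j = i
          · subst hj; simp [γ]
          · simp [γ, hj]
        have h2 : ‖γ t‖ ≤ ‖γ 0‖ + ‖t‖ := by
          rw [h1]; exact (norm_add_le _ _).trans (by simp)
        have h3 := norm_chart_sq (γ t)
        have h4 := norm_chart_sq (γ 0)
        have h5 := norm_nonneg (chart (γ 0))
        have h6 : ‖γ 0‖ ≤ ‖chart (γ 0)‖ := by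
          apply le_of_sq_le_sq _ h5
          linarith
        refine le_of_sq_le_sq ?_ (by positivity)
        have h7 : ‖γ t‖ ^ 2 ≤ (‖γ 0‖ + ‖t‖) ^ 2 := by gcongr
        have h8 : ‖γ 0‖ * ‖t‖ ≤ ‖chart (γ 0)‖ * ‖t‖ := by gcongr
        have := norm_nonneg t
        have h9 : 0 ≤ ‖chart (γ 0)‖ * ‖t‖ := by positivity
        nlinarith [sq_nonneg (‖chart (γ 0)‖ * ‖t‖), mul_nonneg h9 h5, mul_nonneg h9 this]
      have hz' := entire_eq_zero_of_growth m (fun t => f (γ t)) (hd.comp hγ)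
        (C * (1 + ‖chart (γ 0)‖) ^ m)
        (fun t => (hC _).trans (by
          rw [mul_assoc, ← mul_pow]
          gcongr
          exact hγb t))
        (Finset.univ.image fun p : Fin (m + 1) => ((p : ℕ) : ℂ))
        (by
          rw [Finset.card_image_of_injective]
          · simp
          · intro a b hab
            exact Fin.ext (Nat.cast_injective (R := ℂ) hab))
        (by
          intro t ht
          obtain ⟨p, -, rfl⟩ := Finset.mem_image.mp ht
          refine ih _ fun j hj => ?_
          by_cases hji : j = i
          · subst hji; exact ⟨p, by simp⟩
          · obtain ⟨q, hq⟩ := hz j (by simp [hji, hj])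
            exact ⟨q, by simp [hji, hq]⟩)
        (z i)
      simpa [γ] using hz'
  ext z
  exact main Finset.univ z.ofLp (by simp)

instance (n m : ℕ) : FiniteDimensional ℂ (sections n m) :=
  Module.Finite.of_injective (gridEval n m) (gridEval_injective n m)

/-! ### The weighted Bergman space -/

/-- The measure `dν_m(z) = (n+m)! / (πⁿ m!) · dz / (1 + |z₁|² + ⋯ + |zₙ|²)^(n+m+1)` on `ℂⁿ`: the
product of the Hermitian metric of `H^m` and the Fubini-Study volume in the trivialization over
`U₀`. So `L²(ℂⁿ, ν_m)` is the space of square integrable sections of `H^m`. -/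
noncomputable def nu (n m : ℕ) : Measure (Cn n) :=
  volume.withDensity fun z => ENNReal.ofReal
    (((n + m).factorial : ℝ) / (Real.pi ^ n * (m.factorial : ℝ)) / (1 + ‖z‖ ^ 2) ^ (n + m + 1))

theorem sections_memLp {n m : ℕ} {f : Cn n → ℂ} (hf : f ∈ sections n m) :
    MemLp f 2 (nu n m) := by
  have hcont := (sections_differentiable hf).continuous
  obtain ⟨C, hC⟩ := sections_bound hf
  rw [memLp_two_iff_integrable_sq_norm hcont.aestronglyMeasurable, nu,
    integrable_withDensity_iff_integrable_smul' (by fun_prop) (by simp)]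
  have hint : Integrable (fun z : Cn n => ((1 : ℝ) + ‖z‖ ^ 2) ^ (-((2 * n + 2 : ℕ) : ℝ) / 2))
      volume := by
    apply integrable_rpow_neg_one_add_norm_sq
    rw [← Module.finrank_mul_finrank ℝ ℂ (Cn n)]
    simp only [Complex.finrank_real_complex, finrank_euclideanSpace, Fintype.card_fin]
    exact_mod_cast (by omega : 2 * n < 2 * n + 2)
  set c : ℝ := ((n + m).factorial : ℝ) / (Real.pi ^ n * (m.factorial : ℝ)) with hc
  have hc0 : 0 ≤ c := by positivity
  refine (hint.const_mul (c * C ^ 2)).mono'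
    (((by fun_prop : Measurable fun z : Cn n => ENNReal.ofReal (c / (1 + ‖z‖ ^ 2) ^ (n + m + 1))).ennreal_toReal).aestronglyMeasurable.smul (hcont.norm.pow 2).aestronglyMeasurable) (Eventually.of_forall fun z => ?_)
  have hp : 0 < 1 + ‖z‖ ^ 2 := by positivity
  have h1 : ‖f z‖ ^ 2 ≤ C ^ 2 * (1 + ‖z‖ ^ 2) ^ m := by
    calc ‖f z‖ ^ 2 ≤ (C * ‖chart z‖ ^ m) ^ 2 := by gcongr; exact hC z
      _ = C ^ 2 * (‖chart z‖ ^ 2) ^ m := by ring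
      _ = _ := by rw [norm_chart_sq]
  have h2 : ((1 : ℝ) + ‖z‖ ^ 2) ^ (-((2 * n + 2 : ℕ) : ℝ) / 2) = ((1 + ‖z‖ ^ 2) ^ (n + 1))⁻¹ := by
    rw [show (-((2 * n + 2 : ℕ) : ℝ) / 2) = -((n + 1 : ℕ) : ℝ) by push_cast; ring,
      Real.rpow_neg hp.le, Real.rpow_natCast]
  rw [h2, ENNReal.toReal_ofReal (by positivity), smul_eq_mul, Real.norm_of_nonneg (by positivity)]
  calc c / (1 + ‖z‖ ^ 2) ^ (n + m + 1) * ‖f z‖ ^ 2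
      ≤ c / (1 + ‖z‖ ^ 2) ^ (n + m + 1) * (C ^ 2 * (1 + ‖z‖ ^ 2) ^ m) := by gcongr
    _ = c * C ^ 2 * ((1 + ‖z‖ ^ 2) ^ (n + 1))⁻¹ := by
      rw [show n + m + 1 = (n + 1) + m by ring, pow_add]
      field_simp

/-- The class in `L²(ℂⁿ, ν_m)` of a holomorphic section. -/
noncomputable def sectionsToL2 (n m : ℕ) : sections n m →ₗ[ℂ] Lp ℂ 2 (nu n m) where
  toFun f := (sections_memLp f.2).toLp f.1
  map_add' f g := MemLp.toLp_add (sections_memLp f.2) (sections_memLp g.2)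
  map_smul' c f := MemLp.toLp_const_smul c (sections_memLp f.2)

/-- The holomorphic sections of `H^m` as a subspace of `L²(ℂⁿ, ν_m)`. -/
noncomputable def bergmanSubmodule (n m : ℕ) : Submodule ℂ (Lp ℂ 2 (nu n m)) :=
  LinearMap.range (sectionsToL2 n m)

/-- The weighted Bergman space `A²_m(ℙⁿ(ℂ))` of holomorphic sections of `H^m`, with the Hilbert
space structure of `L²(ℂⁿ, ν_m)`. -/
def BergmanSpace (n m : ℕ) : Type := ↥(bergmanSubmodule n m)

noncomputable instance (n m : ℕ) : NormedAddCommGroup (BergmanSpace n m) :=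
  inferInstanceAs (NormedAddCommGroup (bergmanSubmodule n m))

noncomputable instance (n m : ℕ) : InnerProductSpace ℂ (BergmanSpace n m) :=
  inferInstanceAs (InnerProductSpace ℂ (bergmanSubmodule n m))

instance finiteDimensional_bergmanSubmodule (n m : ℕ) :
    FiniteDimensional ℂ (bergmanSubmodule n m) :=
  LinearMap.finiteDimensional_range (sectionsToL2 n m)

instance (n m : ℕ) : FiniteDimensional ℂ (BergmanSpace n m) :=
  finiteDimensional_bergmanSubmodule n m

instance (n m : ℕ) : CompleteSpace (BergmanSpace n m) :=
  FiniteDimensional.complete ℂ (BergmanSpace n m)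

/-- The inclusion of the Bergman space in `L²(ℂⁿ, ν_m)`. -/
noncomputable def inclusion (n m : ℕ) : BergmanSpace n m →L[ℂ] Lp ℂ 2 (nu n m) :=
  (bergmanSubmodule n m).subtypeL

/-- The Bergman projection: the orthogonal projection of `L²(ℂⁿ, ν_m)` onto the Bergman space. -/
noncomputable def bergmanProjection (n m : ℕ) : Lp ℂ 2 (nu n m) →L[ℂ] BergmanSpace n m :=
  (bergmanSubmodule n m).orthogonalProjectionOnto

/-! ### Toeplitz operators -/

/-- Bounded symbols: `L^∞(ℙⁿ(ℂ))`, in inhomogeneous coordinates. -/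
abbrev Symbol (n : ℕ) : Type := Lp ℂ ∞ (volume : Measure (Cn n))

theorem memLp_nu {n : ℕ} (m : ℕ) (a : Symbol n) : MemLp a ∞ (nu n m) :=
  ⟨(Lp.aestronglyMeasurable a).mono_ac (withDensity_absolutelyContinuous _ _),
    (eLpNormEssSup_mono_measure _ (withDensity_absolutelyContinuous _ _)).trans_lt
      (Lp.memLp a).2⟩

/-- Multiplication by a bounded symbol, `f ↦ a f`, on `L²(ℂⁿ, ν_m)`. -/
noncomputable def mulOp {n : ℕ} (m : ℕ) (a : Symbol n) :
    Lp ℂ 2 (nu n m) →L[ℂ] Lp ℂ 2 (nu n m) :=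
  (ContinuousLinearMap.mul ℂ ℂ).holderL (nu n m) ∞ 2 2 ((memLp_nu m a).toLp a)

/-- The Toeplitz operator `T_a f = B_m (a f)` on the Bergman space. -/
noncomputable def toeplitz {n : ℕ} (m : ℕ) (a : Symbol n) :
    BergmanSpace n m →L[ℂ] BergmanSpace n m :=
  bergmanProjection n m ∘L mulOp m a ∘L inclusion n m

/-! ### The action of the unitary group -/

/-- The action `(A, z) ↦ A z` of `U(n)` on `ℂⁿ`. -/
noncomputable def unitaryAct (n : ℕ) :
    Matrix.unitaryGroup (Fin n) ℂ →* (Cn n ≃ₗᵢ[ℂ] Cn n) :=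
  (Unitary.linearIsometryEquiv (𝕜 := ℂ) (H := Cn n)).toMonoidHom.comp
    (Unitary.map
      { toFun := Matrix.toEuclideanCLM (n := Fin n) (𝕜 := ℂ)
        map_one' := map_one _
        map_mul' := map_mul _
        map_star' := map_star _ }).toMonoidHom

theorem unitaryAct_apply {n : ℕ} (A : Matrix.unitaryGroup (Fin n) ℂ) (z : Cn n) :
    unitaryAct n A z = WithLp.toLp 2 (Matrix.mulVec (A : Matrix (Fin n) (Fin n) ℂ) z.ofLp) := rfl

theorem unitaryAct_measurePreserving_volume {n : ℕ} (A : Matrix.unitaryGroup (Fin n) ℂ) :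
    MeasurePreserving (unitaryAct n A) (volume : Measure (Cn n)) volume := by
  let e : Cn n ≃ₗᵢ[ℝ] Cn n :=
    { ((unitaryAct n A).toLinearEquiv.restrictScalars ℝ) with
      norm_map' := (unitaryAct n A).norm_map }
  exact e.measurePreserving

theorem unitaryAct_measurePreserving {n : ℕ} (m : ℕ) (A : Matrix.unitaryGroup (Fin n) ℂ) :
    MeasurePreserving (unitaryAct n A) (nu n m) (nu n m) := by
  have h := unitaryAct_measurePreserving_volume A
  refine ⟨h.measurable, ?_⟩
  ext s hs
  rw [Measure.map_apply h.measurable hs, nu, withDensity_apply _ hs,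
    withDensity_apply _ (h.measurable hs),
    ← h.setLIntegral_comp_preimage hs (by fun_prop)]
  simp

/-- The action of `1 × U(n) ⊆ U(n+1)` on `ℂⁿ⁺¹`. -/
noncomputable def extendAct {n : ℕ} (A : Matrix.unitaryGroup (Fin n) ℂ) (w : Cn (n + 1)) :
    Cn (n + 1) :=
  WithLp.toLp 2 (Fin.cons (w 0) (unitaryAct n A (WithLp.toLp 2 (Fin.tail w.ofLp))).ofLp)

theorem sections_comp_unitary {n m : ℕ} {f : Cn n → ℂ} (hf : f ∈ sections n m)
    (A : Matrix.unitaryGroup (Fin n) ℂ) : f ∘ unitaryAct n A ∈ sections n m := by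
  obtain ⟨F, hF, h⟩ := hf
  have hne : ∀ w : Cn (n + 1), w ≠ 0 → extendAct A w ≠ 0 := by
    intro w hw h0
    apply hw
    have h1 : ∀ i, extendAct A w i = 0 := fun i => by rw [h0]; rfl
    have h2 : w 0 = 0 := h1 0
    have h3 : unitaryAct n A (WithLp.toLp 2 (Fin.tail w.ofLp)) = 0 := by
      ext i
      exact h1 i.succ
    rw [LinearIsometryEquiv.map_eq_zero_iff] at h3
    ext i
    refine Fin.cases h2 (fun j => ?_) i
    exact congrArg (fun v : Cn n => v j) h3
  have hd : Differentiable ℂ (extendAct A) := by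
    rw [differentiable_euclidean]
    intro i
    refine Fin.cases ?_ (fun j => ?_) i
    · simp only [extendAct, Fin.cons_zero]
      fun_prop
    · simp only [extendAct, Fin.cons_succ]
      have h1 : Differentiable ℂ fun w : Cn (n + 1) =>
          (WithLp.toLp 2 (Fin.tail w.ofLp) : Cn n) := by
        rw [differentiable_euclidean]
        intro k
        simp only [Fin.tail]
        fun_prop
      exact (differentiable_euclidean.mp
        ((unitaryAct n A).toContinuousLinearEquiv.differentiable.comp h1)) j
  refine ⟨F ∘ extendAct A, ⟨hF.1.comp hd.differentiableOn fun w hw => hne w hw, ?_⟩, fun z => ?_⟩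
  · intro c hc w hw
    have : extendAct A (c • w) = c • extendAct A w := by
      have h1 : (WithLp.toLp 2 (Fin.tail (c • w).ofLp) : Cn n)
          = c • WithLp.toLp 2 (Fin.tail w.ofLp) := rfl
      ext i
      refine Fin.cases ?_ (fun j => ?_) i
      · simp [extendAct]
      · simp only [extendAct, h1, map_smul]
        simp
    simp only [Function.comp_apply]
    rw [this, hF.2 c hc _ (hne w hw)]
  · simp only [Function.comp_apply]
    rw [h]
    rfl

/-- The operator `f ↦ f (A⁻¹ ·)` on `L²(ℂⁿ, ν_m)`. -/
noncomputable def compUnitary {n : ℕ} (m : ℕ) (A : Matrix.unitaryGroup (Fin n) ℂ) :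
    Lp ℂ 2 (nu n m) →ₗ[ℂ] Lp ℂ 2 (nu n m) :=
  Lp.compMeasurePreservingₗ ℂ (unitaryAct n A⁻¹) (unitaryAct_measurePreserving m A⁻¹)

theorem compUnitary_mem {n m : ℕ} (A : Matrix.unitaryGroup (Fin n) ℂ) {f : Lp ℂ 2 (nu n m)}
    (hf : f ∈ bergmanSubmodule n m) : compUnitary m A f ∈ bergmanSubmodule n m := by
  obtain ⟨g, rfl⟩ := hf
  exact ⟨⟨_, sections_comp_unitary g.2 A⁻¹⟩, rfl⟩

/-- The operator `f ↦ f (A⁻¹ ·)` on the Bergman space. -/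
noncomputable def bergmanAct {n : ℕ} (m : ℕ) (A : Matrix.unitaryGroup (Fin n) ℂ) :
    BergmanSpace n m →ₗ[ℂ] BergmanSpace n m :=
  (compUnitary m A).restrict fun _ hf => compUnitary_mem A hf

theorem inclusion_bergmanAct {n : ℕ} (m : ℕ) (A : Matrix.unitaryGroup (Fin n) ℂ)
    (f : BergmanSpace n m) :
    inclusion n m (bergmanAct m A f) = compUnitary m A (inclusion n m f) := rfl

theorem inclusion_injective (n m : ℕ) : Function.Injective (inclusion n m) :=
  Subtype.val_injective

/-- The unitary representation `π_m` of `U(n)` on the Bergman space, `(A · f)(z) = f (A⁻¹ z)`. -/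
noncomputable def bergmanRep (n m : ℕ) :
    Representation ℂ (Matrix.unitaryGroup (Fin n) ℂ) (BergmanSpace n m) where
  toFun A := bergmanAct m A
  map_one' := by
    refine LinearMap.ext fun f => inclusion_injective n m ?_
    rw [inclusion_bergmanAct]
    apply Lp.ext
    refine (Lp.coeFn_compMeasurePreserving (inclusion n m f)
      (unitaryAct_measurePreserving m 1⁻¹)).trans ?_
    refine Eventually.of_forall fun z => ?_
    simp
  map_mul' A B := by
    refine LinearMap.ext fun f => inclusion_injective n m ?_
    rw [Module.End.mul_apply, inclusion_bergmanAct, inclusion_bergmanAct, inclusion_bergmanAct]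
    generalize inclusion n m f = g
    refine Eq.trans ?_ (Lp.compMeasurePreserving_comp_apply g
      (unitaryAct_measurePreserving m B⁻¹) (unitaryAct_measurePreserving m A⁻¹))
    have h2 : (unitaryAct n (A * B)⁻¹ : Cn n → Cn n) = unitaryAct n B⁻¹ ∘ unitaryAct n A⁻¹ := by
      rw [mul_inv_rev, map_mul]; rfl
    apply Lp.ext
    refine (Lp.coeFn_compMeasurePreserving g
      (unitaryAct_measurePreserving m (A * B)⁻¹)).trans ?_
    refine EventuallyEq.trans ?_ (Lp.coeFn_compMeasurePreserving g _).symm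
    rw [h2]

/-- The restriction of `π_m` to a subgroup `K` of `U(n)`. -/
noncomputable def bergmanRepRestrict {n : ℕ} (m : ℕ)
    (K : Subgroup (Matrix.unitaryGroup (Fin n) ℂ)) : Representation ℂ K (BergmanSpace n m) :=
  (bergmanRep n m).comp K.subtype

/-- The set of `K`-invariant bounded symbols. -/
def invariantSymbols {n : ℕ} (K : Subgroup (Matrix.unitaryGroup (Fin n) ℂ)) : Set (Symbol n) :=
  {a | ∀ k ∈ K, ∀ᵐ z ∂(volume : Measure (Cn n)), a (unitaryAct n k z) = a z}

/-- The C*-algebra of operators on the Bergman space generated by the Toeplitz operators with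
symbols in `S`: the norm closure of the *-algebra that they generate. -/
noncomputable def toeplitzAlgebra {n : ℕ} (m : ℕ) (S : Set (Symbol n)) :
    StarSubalgebra ℂ (BergmanSpace n m →L[ℂ] BergmanSpace n m) :=
  (StarAlgebra.adjoin ℂ (toeplitz m '' S)).topologicalClosure

/-! ### Isotypic decompositions -/

/-- An isotypic decomposition of a `G`-module `W`: a direct sum decomposition of `W` into
`numComponents` submodules `component j`, each of which is the direct sum of `mult j ≥ 1` irreducible
submodules `summand j a`, where the summands of one component are isomorphic to each other and those
of different components are not. So `mult j` is the multiplicity in `component j` of its irreducible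
constituent. -/
structure IsotypicDecomposition {G W : Type*} [Group G] [AddCommGroup W] [Module ℂ W]
    (ρ : Representation ℂ G W) where
  /-- the number of isotypic components -/
  numComponents : ℕ
  /-- the isotypic components -/
  component : Fin numComponents → Submodule ℂ W
  /-- the multiplicities -/
  mult : Fin numComponents → ℕ
  mult_pos : ∀ j, 0 < mult j
  /-- the irreducible summands -/
  summand : ∀ j, Fin (mult j) → Subrepresentation ρ
  irreducible : ∀ j a, (summand j a).toRepresentation.IsIrreducible
  equiv_iff : ∀ j a j' a', Nonempty
    ((summand j a).toRepresentation.Equiv (summand j' a').toRepresentation) ↔ j = j'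
  independent : ∀ j, iSupIndep fun a => (summand j a).toSubmodule
  component_eq : ∀ j, component j = ⨆ a, (summand j a).toSubmodule
  isInternal : DirectSum.IsInternal component

end ProjBergman

/-!
The C*-algebra generated by the Toeplitz operators with `K`-invariant symbols is the commutant of
`K` on the Bergman space (`toeplitzAlgebra_eq_commutant`), and the commutant of a finite-dimensional
unitary representation is a sum of matrix algebras whose sizes are the multiplicities.

A Toeplitz operator with `K`-invariant symbol commutes with `K` because `K` preserves `ν_m`.
Conversely, let `K_z` be the reproducing kernel and assign to an operator `X` the function
`⟪K_z, X K_z⟫ / (1 + ‖K_z‖²)`, which is bounded by `‖X‖`, and which is `K`-invariant if `X` commutes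
with `K`, since `K_{kz} = k · K_z`. Let `L X` be the Toeplitz operator with this symbol
(`toeplitzBerezin`). Then `tr (X* (L X)) = ∫ |⟪K_z, X K_z⟫|² / (1 + ‖K_z‖²) dν_m`, so `L X = 0`
forces `⟪K_z, X K_z⟫ = 0` for all `z`. As `⟪K_q, X K_p⟫` is holomorphic in `q` and antiholomorphic
in `p`, it then vanishes identically (`eq_zero_of_berezin_eq_zero`), and `X = 0`. So `L` restricts
to an injective, hence surjective, linear map of the commutant to itself: each element of the
commutant is a single Toeplitz operator with `K`-invariant symbol (`exists_toeplitz_eq`), and no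
average over `K` is needed.

For the second part, the summands of an isotypic component need not be orthogonal. Fix one of them,
`U`, and a unit vector `u` in it. By Schur's lemma `S* T` is the scalar `⟪S u, T u⟫` for intertwining
maps `S`, `T` from `U` to the whole space, so Gram–Schmidt turns the embeddings of `U` onto the
summands into intertwining maps `T_a` with `T_a* T_b = δ_{ab}`. The operators `T_a T_b*`, taken for
all components, form a system of matrix units that spans the commutant (`exists_matrixUnits`). The
resulting *-isomorphism is isometric, as every *-isomorphism of C*-algebras is.
-/

open scoped InnerProductSpace

namespace ProjBergman

/-! ### Point evaluations and the reproducing kernel -/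

section Bergman

variable {n m : ℕ}

theorem volume_absolutelyContinuous_nu (n m : ℕ) :
    (volume : Measure (Cn n)) ≪ nu n m := by
  refine withDensity_absolutelyContinuous' (by fun_prop) (Eventually.of_forall fun z => ?_)
  have : 0 < ((n + m).factorial : ℝ) / (Real.pi ^ n * (m.factorial : ℝ)) /
      (1 + ‖z‖ ^ 2) ^ (n + m + 1) := by positivity
  simpa using this

theorem nu_absolutelyContinuous_volume (n m : ℕ) :
    nu n m ≪ (volume : Measure (Cn n)) :=
  withDensity_absolutelyContinuous _ _

theorem eq_of_ae_eq_nu {f g : Cn n → ℂ} (hf : Continuous f) (hg : Continuous g)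
    (h : f =ᵐ[nu n m] g) : f = g :=
  (Continuous.ae_eq_iff_eq volume hf hg).mp ((volume_absolutelyContinuous_nu n m).ae_eq h)

theorem sectionsToL2_injective (n m : ℕ) : Function.Injective (sectionsToL2 n m) := by
  intro f g h
  have h1 : f.1 =ᵐ[nu n m] g.1 :=
    (MemLp.coeFn_toLp (sections_memLp f.2)).symm.trans
      ((Lp.ext_iff.mp h).trans (MemLp.coeFn_toLp (sections_memLp g.2)))
  exact Subtype.ext (eq_of_ae_eq_nu (sections_differentiable f.2).continuous
    (sections_differentiable g.2).continuous h1)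

/-- A class in the Bergman space has exactly one holomorphic representative. -/
noncomputable def sectionsEquiv (n m : ℕ) : sections n m ≃ₗ[ℂ] BergmanSpace n m :=
  LinearEquiv.ofInjective (sectionsToL2 n m) (sectionsToL2_injective n m)

/-- The value at `z` of the holomorphic representative. -/
noncomputable def pointEval (z : Cn n) : BergmanSpace n m →ₗ[ℂ] ℂ :=
  LinearMap.proj z ∘ₗ (sections n m).subtype ∘ₗ (sectionsEquiv n m).symm.toLinearMap

theorem differentiable_pointEval (f : BergmanSpace n m) :
    Differentiable ℂ fun z => pointEval z f :=
  sections_differentiable ((sectionsEquiv n m).symm f).2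

theorem inclusion_ae_eq (f : BergmanSpace n m) :
    inclusion n m f =ᵐ[nu n m] fun z => pointEval z f := by
  obtain ⟨g, rfl⟩ := (sectionsEquiv n m).surjective f
  have h : (fun z => pointEval z (sectionsEquiv n m g)) = g.1 := by
    funext z
    simp [pointEval]
  rw [h]
  exact MemLp.coeFn_toLp (sections_memLp g.2)

theorem eq_zero_of_pointEval {f : BergmanSpace n m} (h : ∀ z, pointEval z f = 0) : f = 0 := by
  apply (sectionsEquiv n m).symm.injective
  rw [map_zero]
  exact Subtype.ext (funext h)

theorem pointEval_bergmanRep (A : Matrix.unitaryGroup (Fin n) ℂ) (f : BergmanSpace n m)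
    (z : Cn n) : pointEval z (bergmanRep n m A f) = pointEval (unitaryAct n A⁻¹ z) f := by
  obtain ⟨g, rfl⟩ := (sectionsEquiv n m).surjective f
  have h : bergmanRep n m A (sectionsEquiv n m g) =
      sectionsEquiv n m ⟨_, sections_comp_unitary g.2 A⁻¹⟩ := rfl
  rw [h]
  simp [pointEval]

theorem inner_bergmanRep (A : Matrix.unitaryGroup (Fin n) ℂ) (f g : BergmanSpace n m) :
    ⟪bergmanRep n m A f, bergmanRep n m A g⟫_ℂ = ⟪f, g⟫_ℂ := by
  have h : ∀ f g : BergmanSpace n m, ⟪f, g⟫_ℂ = ∫ z, ⟪pointEval z f, pointEval z g⟫_ℂ ∂(nu n m) := by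
    intro f g
    refine (L2.inner_def (inclusion n m f) (inclusion n m g)).trans (integral_congr_ae ?_)
    filter_upwards [inclusion_ae_eq f, inclusion_ae_eq g] with z h1 h2
    rw [h1, h2]
  rw [h, h]
  simp only [pointEval_bergmanRep]
  exact (unitaryAct_measurePreserving m A⁻¹).integral_comp
    (unitaryAct n A⁻¹).toHomeomorph.measurableEmbedding
    fun z => ⟪pointEval z f, pointEval z g⟫_ℂ

/-- The reproducing kernel: the vector that represents the evaluation at `z`. -/
noncomputable def kernel (m : ℕ) (z : Cn n) : BergmanSpace n m :=
  (InnerProductSpace.toDual ℂ _).symm (LinearMap.toContinuousLinearMap (pointEval z))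

theorem inner_kernel (z : Cn n) (f : BergmanSpace n m) : ⟪kernel m z, f⟫_ℂ = pointEval z f := by
  simp [kernel]

theorem kernel_unitaryAct (A : Matrix.unitaryGroup (Fin n) ℂ) (z : Cn n) :
    kernel m (unitaryAct n A z) = bergmanRep n m A (kernel m z) := by
  refine ext_inner_right ℂ fun f => ?_
  have h1 : bergmanRep n m A (bergmanRep n m A⁻¹ f) = f := by
    rw [← Module.End.mul_apply, ← map_mul, mul_inv_cancel, map_one, Module.End.one_apply]
  rw [inner_kernel]
  conv_rhs => rw [← h1]
  rw [inner_bergmanRep, inner_kernel, pointEval_bergmanRep, inv_inv]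

theorem continuous_kernel : Continuous (kernel (n := n) m) := by
  have h : kernel (n := n) m = fun z => ∑ i, (starRingEnd ℂ)
      (pointEval z (stdOrthonormalBasis ℂ (BergmanSpace n m) i)) •
        stdOrthonormalBasis ℂ (BergmanSpace n m) i := by
    funext z
    conv_lhs => rw [← (stdOrthonormalBasis ℂ (BergmanSpace n m)).sum_repr' (kernel m z)]
    simp_rw [← inner_kernel, inner_conj_symm]
  rw [h]
  refine continuous_finsetSum _ fun i _ => ?_
  have := (differentiable_pointEval (stdOrthonormalBasis ℂ (BergmanSpace n m) i)).continuous
  fun_prop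

/-! ### Injectivity of the Berezin transform -/

/-- `⟪K_q, X K_p⟫` is holomorphic in `q` and antiholomorphic in `p`, so that it is determined by
its values on the diagonal. -/
theorem eq_zero_of_berezin_eq_zero {X : BergmanSpace n m →L[ℂ] BergmanSpace n m}
    (h : ∀ z, ⟪kernel m z, X (kernel m z)⟫_ℂ = 0) : X = 0 := by
  set b := stdOrthonormalBasis ℂ (BergmanSpace n m)
  have hexp : ∀ p q : Cn n, ⟪kernel m q, X (kernel m p)⟫_ℂ =
      ∑ i, (starRingEnd ℂ) (pointEval p (b i)) * pointEval q (X (b i)) := by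
    intro p q
    conv_lhs => rw [← b.sum_repr' (kernel m p)]
    simp only [map_sum, map_smul, inner_sum, inner_smul_right, inner_kernel]
    simp_rw [← inner_kernel, inner_conj_symm]
  have hoff : ∀ p q : Cn n, ⟪kernel m q, X (kernel m p)⟫_ℂ = 0 := by
    intro p q
    -- The points `q = u + i v`, `p = u - i v` are joined by `u + t v`, `u + conj t * v`, which
    -- coincide for real `t`.
    set u : Cn n := (2 : ℂ)⁻¹ • (q + p)
    set v : Cn n := (2 * Complex.I)⁻¹ • (q - p)
    set g : ℂ → ℂ := fun t =>
      ⟪kernel m (u + t • v), X (kernel m (u + (starRingEnd ℂ) t • v))⟫_ℂ with hg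
    have hd : Differentiable ℂ g := by
      simp only [hg, hexp]
      refine Differentiable.fun_sum fun i _ => Differentiable.mul ?_ ?_
      · intro t
        have h1 : Differentiable ℂ fun t : ℂ => pointEval (u + t • v) (b i) :=
          (differentiable_pointEval (b i)).comp (by fun_prop)
        have h2 := (h1 ((starRingEnd ℂ) t)).conj_conj
        simpa [Function.comp_def] using h2
      · exact (differentiable_pointEval (X (b i))).comp (by fun_prop)
    have hreal : ∀ t : ℝ, g t = 0 := fun t => by simpa [hg] using h _
    have hz : Set.EqOn g 0 Set.univ := by
      refine AnalyticOnNhd.eqOn_zero_of_preconnected_of_frequently_eq_zero (z₀ := 0)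
        (fun t _ => hd.analyticAt t) isPreconnected_univ (Set.mem_univ _) ?_
      have hseq : Tendsto (fun k : ℕ => (((1 : ℝ) / ((k : ℝ) + 1) : ℝ) : ℂ)) atTop (𝓝[≠] 0) := by
        rw [tendsto_nhdsWithin_iff]
        refine ⟨?_, Eventually.of_forall fun k => ?_⟩
        · have := (Complex.continuous_ofReal.tendsto 0).comp
            (tendsto_one_div_add_atTop_nhds_zero_nat (𝕜 := ℝ))
          simpa [Function.comp_def] using this
        · have : ((1 : ℝ) / ((k : ℝ) + 1)) ≠ 0 := by positivity
          exact Complex.ofReal_ne_zero.mpr this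
      exact hseq.frequently (Frequently.of_forall fun k => hreal _)
    have hI := hz (Set.mem_univ Complex.I)
    have hq : u + Complex.I • v = q := by
      simp only [u, v, smul_smul, mul_inv, mul_comm (2 : ℂ)⁻¹, ← mul_assoc,
        mul_inv_cancel₀ Complex.I_ne_zero, one_mul]
      module
    have hp : u + (starRingEnd ℂ) Complex.I • v = p := by
      simp only [u, v, smul_smul, mul_inv, mul_comm (2 : ℂ)⁻¹, ← mul_assoc, Complex.conj_I,
        neg_mul, mul_inv_cancel₀ Complex.I_ne_zero, one_mul]
      module
    simpa only [hg, hq, hp, Pi.zero_apply] using hI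
  have hk : ∀ p, X (kernel m p) = 0 := fun p =>
    eq_zero_of_pointEval fun q => by rw [← inner_kernel, hoff]
  have hadj : ContinuousLinearMap.adjoint X = 0 := by
    ext1 f
    refine eq_zero_of_pointEval fun z => ?_
    rw [← inner_kernel, ContinuousLinearMap.adjoint_inner_right, hk, inner_zero_left]
  simpa using hadj

/-! ### Toeplitz operators in terms of point evaluations -/

theorem inner_mulOp_ae_eq (a : Symbol n) (f g : BergmanSpace n m) :
    (fun z => ⟪inclusion n m g z, mulOp m a (inclusion n m f) z⟫_ℂ) =ᵐ[nu n m]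
      fun z => (starRingEnd ℂ) (pointEval z g) * (a z * pointEval z f) := by
  have h2 := (ContinuousLinearMap.mul ℂ ℂ).coeFn_holder (r := 2) ((memLp_nu m a).toLp a)
    (inclusion n m f)
  filter_upwards [h2, inclusion_ae_eq f, inclusion_ae_eq g,
    MemLp.coeFn_toLp (memLp_nu m a)] with z h2 h3 h4 h5
  have h6 : mulOp m a (inclusion n m f) z = a z * pointEval z f := by
    rw [← h3, ← h5]
    exact h2
  rw [h6, h4, RCLike.inner_apply']

theorem inner_toeplitz (a : Symbol n) (f g : BergmanSpace n m) :
    ⟪g, toeplitz m a f⟫_ℂ =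
      ∫ z, (starRingEnd ℂ) (pointEval z g) * (a z * pointEval z f) ∂(nu n m) := by
  have h1 : ⟪g, toeplitz m a f⟫_ℂ = ⟪inclusion n m g, mulOp m a (inclusion n m f)⟫_ℂ :=
    Submodule.inner_orthogonalProjectionOnto_eq_of_mem_left (K := bergmanSubmodule n m) g _
  rw [h1, L2.inner_def]
  exact integral_congr_ae (inner_mulOp_ae_eq a f g)

theorem integrable_toeplitz (a : Symbol n) (f g : BergmanSpace n m) :
    Integrable (fun z => (starRingEnd ℂ) (pointEval z g) * (a z * pointEval z f)) (nu n m) :=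
  (L2.integrable_inner (𝕜 := ℂ) (inclusion n m g) (mulOp m a (inclusion n m f))).congr
    (inner_mulOp_ae_eq a f g)

theorem toeplitz_add (a b : Symbol n) : toeplitz m (a + b) = toeplitz m a + toeplitz m b := by
  ext1 f
  refine ext_inner_left ℂ fun g => ?_
  rw [add_apply, inner_add_right, inner_toeplitz, inner_toeplitz, inner_toeplitz,
    ← integral_add (integrable_toeplitz a f g) (integrable_toeplitz b f g)]
  refine integral_congr_ae ?_
  filter_upwards [(nu_absolutelyContinuous_volume n m).ae_le (Lp.coeFn_add a b)] with z hz
  rw [hz, Pi.add_apply]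
  ring

theorem toeplitz_smul (c : ℂ) (a : Symbol n) : toeplitz m (c • a) = c • toeplitz m a := by
  ext1 f
  refine ext_inner_left ℂ fun g => ?_
  rw [smul_apply, inner_smul_right, inner_toeplitz, inner_toeplitz, ← integral_const_mul]
  refine integral_congr_ae ?_
  filter_upwards [(nu_absolutelyContinuous_volume n m).ae_le (Lp.coeFn_smul c a)] with z hz
  rw [hz, Pi.smul_apply, smul_eq_mul]
  ring

/-- The inner products `⟪k · g, T_a (k · f)⟫` and `⟪g, T_a f⟫` agree, by the change of variables
`z ↦ k z`. -/
theorem toeplitz_commute {K : Subgroup (Matrix.unitaryGroup (Fin n) ℂ)} {a : Symbol n}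
    (ha : a ∈ invariantSymbols K) {k : Matrix.unitaryGroup (Fin n) ℂ} (hk : k ∈ K)
    (f : BergmanSpace n m) :
    toeplitz m a (bergmanRep n m k f) = bergmanRep n m k (toeplitz m a f) := by
  refine ext_inner_left ℂ fun g => ?_
  obtain ⟨g, rfl⟩ : ∃ g', g = bergmanRep n m k g' := ⟨bergmanRep n m k⁻¹ g, by
    rw [← Module.End.mul_apply, ← map_mul, mul_inv_cancel, map_one, Module.End.one_apply]⟩
  rw [inner_bergmanRep, inner_toeplitz, inner_toeplitz,
    ← (unitaryAct_measurePreserving m k).integral_comp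
      (unitaryAct n k).toHomeomorph.measurableEmbedding]
  refine integral_congr_ae ?_
  filter_upwards [(nu_absolutelyContinuous_volume n m).ae_le (ha k hk)] with z hz
  have h1 : unitaryAct n k⁻¹ (unitaryAct n k z) = z := by
    change (unitaryAct n k⁻¹ * unitaryAct n k) z = z
    rw [← map_mul, inv_mul_cancel, map_one]
    rfl
  simp only [pointEval_bergmanRep, h1, hz]

/-! ### Toeplitz quantization of the Berezin transform -/

/-- The Berezin transform `⟪K_z, X K_z⟫` of an operator `X`, made bounded by the `U(n)`-invariant
weight `(1 + ‖K_z‖²)⁻¹`. -/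
noncomputable def berezinFun (X : BergmanSpace n m →L[ℂ] BergmanSpace n m) (z : Cn n) : ℂ :=
  ((1 + ‖kernel m z‖ ^ 2 : ℝ) : ℂ)⁻¹ * ⟪kernel m z, X (kernel m z)⟫_ℂ

theorem continuous_berezinFun (X : BergmanSpace n m →L[ℂ] BergmanSpace n m) :
    Continuous (berezinFun X) := by
  have h := continuous_kernel (n := n) (m := m)
  refine Continuous.mul (Continuous.inv₀ (by fun_prop) fun z => ?_)
    (h.inner (X.continuous.comp h))
  have : 0 < 1 + ‖kernel m z‖ ^ 2 := by positivity
  exact_mod_cast this.ne'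

theorem norm_berezinFun_le (X : BergmanSpace n m →L[ℂ] BergmanSpace n m) (z : Cn n) :
    ‖berezinFun X z‖ ≤ ‖X‖ := by
  have h0 : 0 < 1 + ‖kernel m z‖ ^ 2 := by positivity
  rw [berezinFun, norm_mul, norm_inv, Complex.norm_real, Real.norm_of_nonneg h0.le,
    inv_mul_le_iff₀ h0]
  have h1 := norm_inner_le_norm (𝕜 := ℂ) (kernel m z) (X (kernel m z))
  have h2 := X.le_opNorm (kernel m z)
  nlinarith [norm_nonneg (kernel m z), norm_nonneg X]

theorem memLp_berezinFun (X : BergmanSpace n m →L[ℂ] BergmanSpace n m) :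
    MemLp (berezinFun X) ∞ (volume : Measure (Cn n)) :=
  memLp_top_of_bound (continuous_berezinFun X).aestronglyMeasurable _
    (Eventually.of_forall (norm_berezinFun_le X))

theorem berezinSymbol_mem {K : Subgroup (Matrix.unitaryGroup (Fin n) ℂ)}
    {X : BergmanSpace n m →L[ℂ] BergmanSpace n m}
    (hX : ∀ k ∈ K, ∀ f, X (bergmanRep n m k f) = bergmanRep n m k (X f)) :
    (memLp_berezinFun X).toLp ∈ invariantSymbols K := by
  intro k hk
  have h1 := MemLp.coeFn_toLp (memLp_berezinFun X)
  filter_upwards [h1, (unitaryAct_measurePreserving_volume k).quasiMeasurePreserving.ae h1]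
    with z h2 h3
  have h4 : ‖bergmanRep n m k (kernel m z)‖ = ‖kernel m z‖ := by
    have := inner_bergmanRep (m := m) k (kernel m z) (kernel m z)
    rw [inner_self_eq_norm_sq_to_K, inner_self_eq_norm_sq_to_K] at this
    have h5 : ‖bergmanRep n m k (kernel m z)‖ ^ 2 = ‖kernel m z‖ ^ 2 := by exact_mod_cast this
    exact (sq_eq_sq₀ (norm_nonneg _) (norm_nonneg _)).mp h5
  rw [h2, h3, berezinFun, berezinFun, kernel_unitaryAct, hX k hk, inner_bergmanRep, h4]

/-- The map that sends an operator `X` to the Toeplitz operator whose symbol is the weighted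
Berezin transform of `X`. -/
noncomputable def toeplitzBerezin (n m : ℕ) :
    (BergmanSpace n m →L[ℂ] BergmanSpace n m) →ₗ[ℂ] (BergmanSpace n m →L[ℂ] BergmanSpace n m) where
  toFun X := toeplitz m (memLp_berezinFun X).toLp
  map_add' X Y := by
    rw [← toeplitz_add, ← MemLp.toLp_add]
    congr 2
    funext z
    simp [berezinFun, mul_add]
  map_smul' c X := by
    rw [RingHom.id_apply, ← toeplitz_smul, ← MemLp.toLp_const_smul]
    congr 2
    funext z
    simp [berezinFun, mul_left_comm]

/-- The trace of `X* T_a` is the integral of `a` against the conjugate of the Berezin transform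
of `X`; for the weighted Berezin transform `a` of `X` itself the integrand is nonnegative. -/
theorem toeplitzBerezin_injective (n m : ℕ) : Function.Injective (toeplitzBerezin n m) := by
  rw [← LinearMap.ker_eq_bot, LinearMap.ker_eq_bot']
  intro X hX
  set b := stdOrthonormalBasis ℂ (BergmanSpace n m)
  set a : Symbol n := (memLp_berezinFun X).toLp with ha_def
  have hTa : toeplitz m a = 0 := hX
  set w : Cn n → ℝ := fun z => (1 + ‖kernel m z‖ ^ 2)⁻¹ * ‖⟪kernel m z, X (kernel m z)⟫_ℂ‖ ^ 2
    with hw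
  have hwa : (fun z => ∑ i, (starRingEnd ℂ) (pointEval z (X (b i))) * (a z * pointEval z (b i)))
      =ᵐ[nu n m] fun z => (w z : ℂ) := by
    filter_upwards [(nu_absolutelyContinuous_volume n m).ae_le
      (MemLp.coeFn_toLp (memLp_berezinFun X))] with z hz
    have h1 : ∑ i, (starRingEnd ℂ) (pointEval z (X (b i))) * pointEval z (b i) =
        (starRingEnd ℂ) ⟪kernel m z, X (kernel m z)⟫_ℂ := by
      have h2 : ⟪X.adjoint (kernel m z), kernel m z⟫_ℂ = ⟪kernel m z, X (kernel m z)⟫_ℂ :=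
        ContinuousLinearMap.adjoint_inner_left X _ _
      rw [← h2, inner_conj_symm, ← b.sum_inner_mul_inner]
      refine Finset.sum_congr rfl fun i _ => ?_
      rw [← inner_kernel, ← inner_kernel, inner_conj_symm,
        ContinuousLinearMap.adjoint_inner_right]
      ring
    have h3 : ∀ i, (starRingEnd ℂ) (pointEval z (X (b i))) * (a z * pointEval z (b i)) =
        a z * ((starRingEnd ℂ) (pointEval z (X (b i))) * pointEval z (b i)) := fun i => by ring
    simp_rw [h3]
    rw [← Finset.mul_sum, h1, hz, berezinFun, mul_assoc, Complex.mul_conj,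
      Complex.normSq_eq_norm_sq]
    simp [hw]
  have hint : Integrable (fun z => (w z : ℂ)) (nu n m) :=
    (integrable_finsetSum _ fun i _ => integrable_toeplitz a (b i) (X (b i))).congr hwa
  have hzero : ∫ z, (w z : ℂ) ∂(nu n m) = 0 := by
    rw [← integral_congr_ae hwa,
      integral_finsetSum _ fun i _ => integrable_toeplitz a (b i) (X (b i))]
    refine Finset.sum_eq_zero fun i _ => ?_
    rw [← inner_toeplitz, hTa]
    simp
  have hw0 : w =ᵐ[nu n m] 0 := by
    rw [← integral_eq_zero_iff_of_nonneg (fun z => by positivity)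
      (by simpa using hint.re)]
    rw [integral_complex_ofReal] at hzero
    exact_mod_cast hzero
  have hB : (fun z => ⟪kernel m z, X (kernel m z)⟫_ℂ) = fun _ => 0 := by
    have hc := continuous_kernel (n := n) (m := m)
    refine eq_of_ae_eq_nu (m := m) (hc.inner (X.continuous.comp hc)) continuous_const ?_
    filter_upwards [hw0] with z hz
    have h0 : (1 + ‖kernel m z‖ ^ 2)⁻¹ ≠ 0 := by positivity
    simpa [hw, h0] using hz
  exact eq_zero_of_berezin_eq_zero fun z => congrFun hB z

/-- Every operator that commutes with `K` is a Toeplitz operator with `K`-invariant symbol: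
`toeplitzBerezin` is injective and maps the commutant of `K`, a finite-dimensional space,
to itself. -/
theorem exists_toeplitz_eq {K : Subgroup (Matrix.unitaryGroup (Fin n) ℂ)}
    {X : BergmanSpace n m →L[ℂ] BergmanSpace n m}
    (hX : ∀ k ∈ K, ∀ f, X (bergmanRep n m k f) = bergmanRep n m k (X f)) :
    ∃ a ∈ invariantSymbols K, toeplitz m a = X := by
  let C : Submodule ℂ (BergmanSpace n m →L[ℂ] BergmanSpace n m) :=
    { carrier := {Y | ∀ k ∈ K, ∀ f, Y (bergmanRep n m k f) = bergmanRep n m k (Y f)}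
      add_mem' := fun {Y Z} hY hZ k hk f => by
        rw [add_apply, add_apply, hY k hk, hZ k hk, map_add]
      zero_mem' := fun k _ f => by simp
      smul_mem' := fun c Y hY k hk f => by rw [smul_apply, smul_apply, hY k hk, map_smul] }
  have hC : ∀ Y ∈ C, toeplitzBerezin n m Y ∈ C := fun Y hY k hk f =>
    toeplitz_commute (berezinSymbol_mem hY) hk f
  have hinj : Function.Injective ((toeplitzBerezin n m).restrict hC) := fun Y Z h =>
    Subtype.ext (toeplitzBerezin_injective n m (congrArg Subtype.val h))
  obtain ⟨Y, hY⟩ := LinearMap.surjective_of_injective hinj ⟨X, hX⟩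
  exact ⟨_, berezinSymbol_mem Y.2, congrArg Subtype.val hY⟩

end Bergman

/-! ### Systems of matrix units -/

section MatrixUnits

/-- A system of matrix units of type `⨁ i, M_{r i}(ℂ)` in a *-algebra. -/
structure MatrixUnits {ι : Type*} [Fintype ι] (r : ι → ℕ) (A : Type*) [Ring A] [StarRing A] where
  /-- the image of the elementary matrix with entry `1` at `(a, b)` in the block `i` -/
  unit : ∀ i, Fin (r i) → Fin (r i) → A
  mul_same : ∀ i a b c d, unit i a b * unit i c d = if b = c then unit i a d else 0
  mul_ne : ∀ {i j}, i ≠ j → ∀ a b c d, unit i a b * unit j c d = 0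
  star_unit : ∀ i a b, star (unit i a b) = unit i b a
  sum_diag : ∑ i, ∑ a, unit i a a = 1
  ne_zero : ∀ i a b, unit i a b ≠ 0

namespace MatrixUnits

variable {ι : Type*} [Fintype ι] {r : ι → ℕ} {A : Type*} [Ring A] [StarRing A] [Algebra ℂ A]

/-- The linear combination of the matrix units whose coefficients are the entries of `M`. -/
noncomputable def combination (e : MatrixUnits r A) (M : ∀ i, Matrix (Fin (r i)) (Fin (r i)) ℂ) :
    A :=
  ∑ i, ∑ a, ∑ b, M i a b • e.unit i a b

theorem unit_mul_combination (e : MatrixUnits r A)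
    (M : ∀ i, Matrix (Fin (r i)) (Fin (r i)) ℂ) (j : ι) (c d : Fin (r j)) :
    e.unit j c d * e.combination M = ∑ b, M j d b • e.unit j c b := by
  rw [combination, Finset.mul_sum, Finset.sum_eq_single j]
  · simp [Finset.mul_sum, e.mul_same]
  · intro i _ hij
    simp [Finset.mul_sum, e.mul_ne hij.symm]
  · simp

theorem unit_mul_combination_mul_unit (e : MatrixUnits r A)
    (M : ∀ i, Matrix (Fin (r i)) (Fin (r i)) ℂ) (j : ι) (c d : Fin (r j)) :
    e.unit j c c * e.combination M * e.unit j d d = M j c d • e.unit j c d := by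
  simp [unit_mul_combination, Finset.sum_mul, e.mul_same]

theorem combination_mul (e : MatrixUnits r A) (M N : ∀ i, Matrix (Fin (r i)) (Fin (r i)) ℂ) :
    e.combination (M * N) = e.combination M * e.combination N := by
  conv_rhs => rw [combination]
  simp only [Finset.sum_mul, smul_mul_assoc, unit_mul_combination, Finset.smul_sum, smul_smul]
  refine Finset.sum_congr rfl fun i _ => Finset.sum_congr rfl fun a _ => ?_
  rw [Finset.sum_comm]
  simp only [Pi.mul_apply, Matrix.mul_apply, Finset.sum_smul]

variable [StarModule ℂ A]

/-- The *-homomorphism from a sum of matrix algebras that a system of matrix units defines. -/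
noncomputable def toStarAlgHom (e : MatrixUnits r A) :
    (∀ i, Matrix (Fin (r i)) (Fin (r i)) ℂ) →⋆ₐ[ℂ] A where
  toFun := e.combination
  map_one' := by simp [combination, Matrix.one_apply, ← e.sum_diag]
  map_mul' := e.combination_mul
  map_zero' := by simp [combination]
  map_add' M N := by simp [combination, add_smul, Finset.sum_add_distrib]
  commutes' c := by
    simp [combination, Matrix.algebraMap_matrix_apply, ← Finset.smul_sum, e.sum_diag,
      Algebra.algebraMap_eq_smul_one]
  map_star' M := by
    simp only [combination, star_sum, star_smul, e.star_unit]
    refine Finset.sum_congr rfl fun i _ => ?_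
    rw [Finset.sum_comm]
    simp [Matrix.star_apply]

theorem toStarAlgHom_injective (e : MatrixUnits r A) : Function.Injective e.toStarAlgHom := by
  rw [injective_iff_map_eq_zero]
  intro M hM
  ext i a b
  have h := e.unit_mul_combination_mul_unit M i a b
  rw [show e.combination M = 0 from hM, mul_zero, zero_mul] at h
  simpa using (smul_eq_zero.mp h.symm).resolve_right (e.ne_zero i a b)

theorem toStarAlgHom_surjective (e : MatrixUnits r A)
    (hsame : ∀ X i a b, ∃ c : ℂ, e.unit i a a * X * e.unit i b b = c • e.unit i a b)
    (hne : ∀ X i j a b, i ≠ j → e.unit i a a * X * e.unit j b b = 0) :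
    Function.Surjective e.toStarAlgHom := by
  intro X
  choose M hM using hsame X
  refine ⟨fun i => Matrix.of (M i), ?_⟩
  change e.combination _ = X
  have hX : X = (∑ i, ∑ a, e.unit i a a) * X * ∑ j, ∑ b, e.unit j b b := by
    rw [e.sum_diag, one_mul, mul_one]
  rw [hX, combination, Finset.sum_mul, Finset.sum_mul]
  refine Finset.sum_congr rfl fun i _ => ?_
  rw [Finset.mul_sum, Finset.sum_eq_single i]
  · simp only [Finset.sum_mul, Finset.mul_sum, hM, Matrix.of_apply]
    exact Finset.sum_comm
  · intro j _ hj
    simp [Finset.sum_mul, Finset.mul_sum, hne X i j _ _ hj.symm]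
  · simp

/-- A *-algebra in which a system of matrix units spans is a sum of matrix algebras. -/
noncomputable def starAlgEquiv (e : MatrixUnits r A)
    (hsame : ∀ X i a b, ∃ c : ℂ, e.unit i a a * X * e.unit i b b = c • e.unit i a b)
    (hne : ∀ X i j a b, i ≠ j → e.unit i a a * X * e.unit j b b = 0) :
    A ≃⋆ₐ[ℂ] ∀ i, Matrix (Fin (r i)) (Fin (r i)) ℂ :=
  (StarAlgEquiv.ofBijective e.toStarAlgHom
    ⟨e.toStarAlgHom_injective, e.toStarAlgHom_surjective hsame hne⟩).symm

end MatrixUnits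

theorem pi_matrix_commute_iff {ι : Type*} (r : ι → ℕ) (hr : ∀ i, 0 < r i) :
    (∀ M N : ∀ i, Matrix (Fin (r i)) (Fin (r i)) ℂ, M * N = N * M) ↔ ∀ i, r i = 1 := by
  classical
  refine ⟨fun h i => ?_, fun h M N => ?_⟩
  · by_contra hi
    have hi2 : 1 < r i := by have := hr i; omega
    let x : Fin (r i) := ⟨0, hr i⟩
    let y : Fin (r i) := ⟨1, hi2⟩
    have hxy : y ≠ x := by simp [x, y]
    -- `E₀₁ E₁₀ = E₀₀`, whereas `E₁₀ E₀₁ = E₁₁`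
    have := congrFun (h (Pi.single i (Matrix.single x y 1)) (Pi.single i (Matrix.single y x 1))) i
    have := congrFun (congrFun this x) x
    simp [Matrix.single_mul_single_same, hxy] at this
  · funext i
    have hs : Subsingleton (Fin (r i)) := by rw [h i]; infer_instance
    ext a b
    obtain rfl := hs.elim a b
    simp only [Pi.mul_apply, Matrix.mul_apply]
    refine Finset.sum_congr rfl fun c _ => ?_
    obtain rfl := hs.elim a c
    exact mul_comm _ _

end MatrixUnits

/-! ### Unitary representations and their intertwining maps -/

section UnitaryRepresentations

open Representation

variable {G U V : Type*} [Group G]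
  [NormedAddCommGroup U] [InnerProductSpace ℂ U]
  [NormedAddCommGroup V] [InnerProductSpace ℂ V]

/-- The operators `ρ g` preserve the inner product. -/
def IsUnitaryRep (ρ : Representation ℂ G V) : Prop :=
  ∀ g x y, ⟪ρ g x, ρ g y⟫_ℂ = ⟪x, y⟫_ℂ

theorem IsUnitaryRep.inner_left {ρ : Representation ℂ G V} (hρ : IsUnitaryRep ρ) (g : G)
    (x y : V) : ⟪ρ g x, y⟫_ℂ = ⟪x, ρ g⁻¹ y⟫_ℂ := by
  rw [← hρ g x (ρ g⁻¹ y), ρ.self_inv_apply]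

theorem IsUnitaryRep.subrepresentation {ρ : Representation ℂ G V} (hρ : IsUnitaryRep ρ)
    (P : Subrepresentation ρ) : IsUnitaryRep P.toRepresentation :=
  fun g x y => hρ g x y

theorem eq_of_apply_eq {σ : Representation ℂ G U} {ρ : Representation ℂ G V}
    (hσ : σ.IsIrreducible) {u : U} (hu : u ≠ 0) {S T : IntertwiningMap σ ρ} (h : S u = T u) :
    S = T := by
  rcases IsIrreducible.injective_or_eq_zero (S - T) with h1 | h1
  · refine absurd (h1 (a₁ := u) (a₂ := 0) ?_) hu
    rw [map_zero, IntertwiningMap.coe_sub, Pi.sub_apply, h, sub_self]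
  · exact sub_eq_zero.mp h1

variable [FiniteDimensional ℂ U] [FiniteDimensional ℂ V]

/-- The adjoint of an intertwining map between unitary representations. -/
noncomputable def adjointMap {σ : Representation ℂ G U} {ρ : Representation ℂ G V}
    (hσ : IsUnitaryRep σ) (hρ : IsUnitaryRep ρ) (T : IntertwiningMap σ ρ) :
    IntertwiningMap ρ σ where
  toLinearMap := LinearMap.adjoint T.toLinearMap
  isIntertwining' g := by
    ext v
    refine ext_inner_right ℂ fun u => ?_
    rw [LinearMap.comp_apply, LinearMap.comp_apply, LinearMap.adjoint_inner_left, hρ.inner_left,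
      hσ.inner_left, LinearMap.adjoint_inner_left, T.toLinearMap_apply, T.toLinearMap_apply,
      T.isIntertwining]

theorem inner_adjointMap_left {σ : Representation ℂ G U} {ρ : Representation ℂ G V}
    (hσ : IsUnitaryRep σ) (hρ : IsUnitaryRep ρ) (T : IntertwiningMap σ ρ) (v : V) (u : U) :
    ⟪adjointMap hσ hρ T v, u⟫_ℂ = ⟪v, T u⟫_ℂ :=
  LinearMap.adjoint_inner_left _ _ _

theorem inner_adjointMap_right {σ : Representation ℂ G U} {ρ : Representation ℂ G V}
    (hσ : IsUnitaryRep σ) (hρ : IsUnitaryRep ρ) (T : IntertwiningMap σ ρ) (v : V) (u : U) :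
    ⟪u, adjointMap hσ hρ T v⟫_ℂ = ⟪T u, v⟫_ℂ :=
  LinearMap.adjoint_inner_right _ _ _

/-- Schur's lemma for endomorphisms. -/
theorem exists_smul_of_irreducible {σ : Representation ℂ G U} (hσ : σ.IsIrreducible)
    (f : IntertwiningMap σ σ) : ∃ c : ℂ, ∀ u, f u = c • u := by
  obtain ⟨c, rfl⟩ := (IsIrreducible.algebraMap_intertwiningMap_bijective_of_isAlgClosed
    (k := ℂ) (ρ := σ)).2 f
  refine ⟨c, fun u => ?_⟩
  rw [Algebra.algebraMap_eq_smul_one]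
  rfl

/-- The commutant of a representation. The operators `ρ g` and their adjoints are both required
to commute, which makes it a *-algebra; for unitary `ρ` the second condition is redundant. -/
noncomputable def commutant (ρ : Representation ℂ G V) : StarSubalgebra ℂ (V →L[ℂ] V) :=
  StarSubalgebra.centralizer ℂ (Set.range fun g => LinearMap.toContinuousLinearMap (ρ g))

theorem mem_commutant {ρ : Representation ℂ G V} (hρ : IsUnitaryRep ρ) {X : V →L[ℂ] V} :
    X ∈ commutant ρ ↔ ∀ g v, X (ρ g v) = ρ g (X v) := by
  have hstar : ∀ g, star (LinearMap.toContinuousLinearMap (ρ g)) =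
      LinearMap.toContinuousLinearMap (ρ g⁻¹) := by
    intro g
    rw [ContinuousLinearMap.star_eq_adjoint, eq_comm, ContinuousLinearMap.eq_adjoint_iff]
    intro x y
    simpa using hρ.inner_left g⁻¹ x y
  rw [commutant, StarSubalgebra.mem_centralizer_iff]
  constructor
  · intro h g v
    exact (congrArg (fun Y : V →L[ℂ] V => Y v) (h _ ⟨g, rfl⟩).1).symm
  · rintro h _ ⟨g, rfl⟩
    dsimp only
    rw [hstar]
    exact ⟨ContinuousLinearMap.ext fun v => (h g v).symm,
      ContinuousLinearMap.ext fun v => (h g⁻¹ v).symm⟩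

/-- An element of the commutant as an intertwining map. -/
def commutantMap {ρ : Representation ℂ G V} (hρ : IsUnitaryRep ρ) (X : commutant ρ) :
    IntertwiningMap ρ ρ where
  toLinearMap := X.1
  isIntertwining' g := LinearMap.ext fun v => (mem_commutant hρ).mp X.2 g v

/-- An intertwining map of `ρ` with itself as an element of the commutant. -/
noncomputable def toCommutant {ρ : Representation ℂ G V} (hρ : IsUnitaryRep ρ) (f : IntertwiningMap ρ ρ) :
    commutant ρ :=
  ⟨LinearMap.toContinuousLinearMap f.toLinearMap, (mem_commutant hρ).mpr f.isIntertwining⟩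

theorem commutant_ext {ρ : Representation ℂ G V} {X Y : commutant ρ}
    (h : ∀ v, X.1 v = Y.1 v) : X = Y :=
  Subtype.ext (ContinuousLinearMap.ext h)

end UnitaryRepresentations

/-! ### The commutant and the isotypic decompositions -/

section Commutant

open Representation

variable {G V : Type*} [Group G]
  [NormedAddCommGroup V] [InnerProductSpace ℂ V]
  {ρ : Representation ℂ G V}

namespace IsotypicDecomposition

/-- The first summand of the `j`-th component, as a model of the irreducible representation of
this component. -/
def model (d : IsotypicDecomposition ρ) (j : Fin d.numComponents) : Subrepresentation ρ :=
  d.summand j ⟨0, d.mult_pos j⟩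

theorem model_irreducible (d : IsotypicDecomposition ρ) (j : Fin d.numComponents) :
    (d.model j).toRepresentation.IsIrreducible :=
  d.irreducible j _

theorem intertwiningMap_model_eq_zero (d : IsotypicDecomposition ρ) {i j : Fin d.numComponents}
    (hij : i ≠ j)
    (f : IntertwiningMap (d.model i).toRepresentation (d.model j).toRepresentation) : f = 0 := by
  have := d.model_irreducible i
  have := d.model_irreducible j
  have : IsEmpty ((d.model i).toRepresentation.Equiv (d.model j).toRepresentation) :=
    not_nonempty_iff.mp fun h => hij ((d.equiv_iff _ _ _ _).mp h)
  exact Subsingleton.elim _ _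

theorem exists_ne_zero (d : IsotypicDecomposition ρ) (j : Fin d.numComponents) :
    ∃ u : (d.model j).toSubmodule, u ≠ 0 := by
  have := d.model_irreducible j
  by_contra! h
  refine bot_ne_top (α := Subrepresentation (d.model j).toRepresentation) ?_
  refine SetLike.ext fun u => ?_
  rw [h u]
  exact ⟨fun _ => trivial, fun _ => Submodule.zero_mem _⟩

/-- An isomorphism of the model onto the summand `a`, followed by the inclusion. -/
theorem exists_embedding (d : IsotypicDecomposition ρ) (j : Fin d.numComponents)
    (a : Fin (d.mult j)) : ∃ f : IntertwiningMap (d.model j).toRepresentation ρ,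
      Function.Injective f ∧ ∀ v, v ∈ (d.summand j a).toSubmodule ↔ ∃ u, f u = v := by
  obtain ⟨e⟩ := (d.equiv_iff j ⟨0, d.mult_pos j⟩ j a).mpr rfl
  refine ⟨⟨(d.summand j a).toSubmodule.subtype ∘ₗ e.toLinearMap, fun g => ?_⟩, ?_, fun v => ?_⟩
  · ext u
    exact congrArg Subtype.val (e.toIntertwiningMap.isIntertwining _ _ g u)
  · exact Subtype.val_injective.comp e.toLinearEquiv.injective
  · constructor
    · intro hv
      obtain ⟨u, hu⟩ := e.toLinearEquiv.surjective ⟨v, hv⟩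
      exact ⟨u, congrArg Subtype.val hu⟩
    · rintro ⟨u, rfl⟩
      exact (e.toLinearEquiv u).2

variable [FiniteDimensional ℂ V]

/-- Gram–Schmidt for intertwining maps: for a fixed unit vector `u` of the model, an intertwining
map is determined by its value at `u`, and `S* T` is the scalar `⟪S u, T u⟫`. -/
theorem exists_orthonormal_intertwiningMaps (d : IsotypicDecomposition ρ) (hρ : IsUnitaryRep ρ)
    (j : Fin d.numComponents) :
    ∃ T : Fin (d.mult j) → IntertwiningMap (d.model j).toRepresentation ρ,
      (∀ a b u, adjointMap (hρ.subrepresentation _) hρ (T a) (T b u) = if a = b then u else 0) ∧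
      ∀ v ∈ d.component j, ∃ u : Fin (d.mult j) → (d.model j).toSubmodule,
        v = ∑ a, T a (u a) := by
  choose f hf_inj hf using d.exists_embedding j
  obtain ⟨u₁, hu₁⟩ := d.exists_ne_zero j
  obtain ⟨u, hu⟩ : ∃ u : (d.model j).toSubmodule, ‖u‖ = 1 :=
    ⟨_, norm_smul_inv_norm (𝕜 := ℂ) hu₁⟩
  have hu0 : u ≠ 0 := by
    rintro rfl
    simp at hu
  have hirr := d.model_irreducible j
  set x : Fin (d.mult j) → V := fun a => f a u with hx
  have hli : LinearIndependent ℂ x := by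
    refine (d.independent j).linearIndependent _ (fun a => (hf a _).mpr ⟨u, rfl⟩) fun a h => hu0 ?_
    exact hf_inj a (h.trans (map_zero (f a)).symm)
  set y := InnerProductSpace.gramSchmidtNormed ℂ x
  have hy : Orthonormal ℂ y := InnerProductSpace.gramSchmidtNormed_orthonormal hli
  have hspan : Submodule.span ℂ (Set.range y) = Submodule.span ℂ (Set.range x) := by
    rw [InnerProductSpace.span_gramSchmidtNormed_range, InnerProductSpace.span_gramSchmidt]
  have hyx : ∀ a, ∃ c : Fin (d.mult j) → ℂ, ∑ b, c b • x b = y a := fun a =>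
    (Submodule.mem_span_range_iff_exists_fun ℂ).mp (hspan ▸ Submodule.subset_span ⟨a, rfl⟩)
  have hxy : ∀ a, ∃ c : Fin (d.mult j) → ℂ, ∑ b, c b • y b = x a := fun a =>
    (Submodule.mem_span_range_iff_exists_fun ℂ).mp (hspan ▸ Submodule.subset_span ⟨a, rfl⟩)
  choose c hc using hyx
  choose c' hc' using hxy
  set T : Fin (d.mult j) → IntertwiningMap (d.model j).toRepresentation ρ :=
    fun a => ∑ b, c a b • f b with hT
  have hTu : ∀ a, T a u = y a := fun a => by
    rw [← hc a, hT]
    simp [IntertwiningMap.sum_apply, hx]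
  refine ⟨T, fun a b w => ?_, fun v hv => ?_⟩
  · obtain ⟨s, hs⟩ := exists_smul_of_irreducible hirr
      ((adjointMap (hρ.subrepresentation _) hρ (T a)).comp (T b))
    simp only [IntertwiningMap.comp_apply] at hs
    have h1 : ⟪u, s • u⟫_ℂ = if a = b then 1 else 0 := by
      rw [← hs, inner_adjointMap_right, hTu, hTu]
      exact orthonormal_iff_ite.mp hy a b
    rw [inner_smul_right, inner_self_eq_norm_sq_to_K, hu] at h1
    have h2 : s = if a = b then 1 else 0 := by simpa using h1
    rw [hs, h2]
    split_ifs <;> simp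
  · have hle : d.component j ≤ ⨆ a, LinearMap.range (T a).toLinearMap := by
      rw [d.component_eq]
      refine iSup_le fun a v hv => ?_
      obtain ⟨w, rfl⟩ := (hf a v).mp hv
      have h1 : f a = ∑ b, c' a b • T b := by
        refine eq_of_apply_eq hirr hu0 ?_
        simp [IntertwiningMap.sum_apply, hTu, hc', hx]
      rw [h1, IntertwiningMap.sum_apply]
      refine Submodule.sum_mem _ fun b _ => Submodule.smul_mem _ _ ?_
      exact Submodule.mem_iSup_of_mem b ⟨w, rfl⟩
    obtain ⟨g, hg⟩ := (Submodule.mem_iSup_iff_exists_finsupp _ _).mp (hle hv)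
    choose w hw using hg.1
    refine ⟨w, ?_⟩
    rw [← hg.2, Finsupp.sum_fintype _ _ fun _ => rfl]
    exact Finset.sum_congr rfl fun a _ => (hw a).symm

/-- The matrix units `T_a T_b*` of the commutant, for orthonormal intertwining maps `T_a` from the
model of each component. -/
theorem exists_matrixUnits (d : IsotypicDecomposition ρ) (hρ : IsUnitaryRep ρ) :
    ∃ e : MatrixUnits d.mult (commutant ρ),
      (∀ X i a b, ∃ c : ℂ, e.unit i a a * X * e.unit i b b = c • e.unit i a b) ∧
      ∀ X i j a b, i ≠ j → e.unit i a a * X * e.unit j b b = 0 := by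
  choose T hT hspan using d.exists_orthonormal_intertwiningMaps hρ
  let S := fun j a => adjointMap (hρ.subrepresentation (d.model j)) hρ (T j a)
  have hS : ∀ j a b u, S j a (T j b u) = if a = b then u else 0 := hT
  have hne : ∀ {i j}, i ≠ j → ∀ (f : IntertwiningMap ρ ρ) a b u, S i a (f (T j b u)) = 0 :=
    fun {i j} hij f a b u => by
      have := d.intertwiningMap_model_eq_zero hij.symm ((S i a).comp (f.comp (T j b)))
      exact congrArg (fun f => f u) this
  have hne' : ∀ {i j}, i ≠ j → ∀ a b u, S i a (T j b u) = 0 := fun hij a b u =>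
    hne hij (IntertwiningMap.id ρ) a b u
  have happly : ∀ j a b v, (toCommutant hρ ((T j a).comp (S j b))).1 v = T j a (S j b v) :=
    fun _ _ _ _ => rfl
  refine ⟨⟨fun j a b => toCommutant hρ ((T j a).comp (S j b)), ?_, ?_, ?_, ?_, ?_⟩, ?_, ?_⟩
  · intro j a b a' b'
    refine commutant_ext fun v => ?_
    refine (congrArg (T j a) (hS j b a' (S j b' v))).trans ?_
    split_ifs
    · rfl
    · exact map_zero _
  · intro i j hij a b a' b'
    refine commutant_ext fun v => ?_
    exact (congrArg (T i a) (hne' hij b a' (S j b' v))).trans (map_zero _)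
  · intro j a b
    refine Subtype.ext ?_
    change star (toCommutant hρ ((T j a).comp (S j b))).1 = _
    rw [ContinuousLinearMap.star_eq_adjoint, eq_comm, ContinuousLinearMap.eq_adjoint_iff]
    intro v w
    rw [happly, happly, ← inner_adjointMap_right (hρ.subrepresentation _) hρ,
      ← inner_adjointMap_left (hρ.subrepresentation _) hρ]
  · refine commutant_ext fun v => ?_
    have hsum : (∑ j, ∑ a, toCommutant hρ ((T j a).comp (S j a))).1 v =
        ∑ j, ∑ a, T j a (S j a v) := by
      simp only [AddSubmonoidClass.coe_finsetSum, sum_apply, happly]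
    rw [hsum]
    change _ = v
    let Q : V →ₗ[ℂ] V := ∑ j, ∑ a, (T j a).toLinearMap ∘ₗ (S j a).toLinearMap
    have hQ : ∀ v, Q v = ∑ j, ∑ a, T j a (S j a v) := fun v => by
      simp [Q, LinearMap.sum_apply]
    rw [← hQ]
    have htop : (⊤ : Submodule ℂ V) ≤ LinearMap.eqLocus Q LinearMap.id := by
      rw [← d.isInternal.submodule_iSup_eq_top]
      refine iSup_le fun j v hv => ?_
      obtain ⟨u, rfl⟩ := hspan j v hv
      rw [LinearMap.mem_eqLocus, map_sum, map_sum]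
      refine Finset.sum_congr rfl fun b _ => ?_
      rw [hQ, Finset.sum_eq_single j]
      · simp only [hS, apply_ite (T j _), map_zero]
        simp
      · intro i _ hij
        simp [hne' hij]
      · simp
    exact htop (Submodule.mem_top (x := v))
  · intro j a b h
    obtain ⟨u, hu⟩ := d.exists_ne_zero j
    refine hu ?_
    have h1 : T j a (S j b (T j b u)) = 0 := by
      rw [← happly, h]
      rfl
    have h2 := congrArg (S j a) h1
    simpa [hS] using h2
  · intro X j a b
    obtain ⟨c, hc⟩ := exists_smul_of_irreducible (d.model_irreducible j)
      ((S j a).comp ((commutantMap hρ X).comp (T j b)))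
    refine ⟨c, commutant_ext fun v => ?_⟩
    exact (congrArg (T j a) (hc (S j b v))).trans (map_smul _ _ _)
  · intro X i j a b hij
    refine commutant_ext fun v => ?_
    exact (congrArg (T i a) (hne hij (commutantMap hρ X) a b (S j b v))).trans (map_zero _)

end IsotypicDecomposition

end Commutant

/-! ### Existence of isotypic decompositions -/

section Existence

variable {G V : Type*} [Group G] [NormedAddCommGroup V] [InnerProductSpace ℂ V]
  {ρ : Representation ℂ G V}

/-- The intersection of `P` with the orthogonal complement of `Q`. -/
noncomputable def orthogonalIn (hρ : IsUnitaryRep ρ) (P Q : Subrepresentation ρ) : Subrepresentation ρ where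
  toSubmodule := Q.toSubmoduleᗮ ⊓ P.toSubmodule
  apply_mem_toSubmodule g v hv := by
    refine ⟨(Submodule.mem_orthogonal' _ _).mpr fun u hu => ?_, P.apply_mem_toSubmodule g hv.2⟩
    rw [hρ.inner_left]
    exact (Submodule.mem_orthogonal' _ _).mp hv.1 _ (Q.apply_mem_toSubmodule _ hu)

/-- Irreducibility of `P` as a representation, tested on the subrepresentations of the ambient
space that lie in `P`. -/
theorem irreducible_of_forall_le (P : Subrepresentation ρ) (hP : P ≠ ⊥)
    (h : ∀ Q : Subrepresentation ρ, Q ≤ P → Q = ⊥ ∨ Q = P) :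
    P.toRepresentation.IsIrreducible := by
  have hnt : ∃ u : P.toSubmodule, u ≠ 0 := by
    by_contra! h0
    refine hP (SetLike.ext fun v => ⟨fun hv => ?_, fun hv => ?_⟩)
    · exact congrArg Subtype.val (h0 ⟨v, hv⟩)
    · rw [show v = 0 from hv]
      exact P.toSubmodule.zero_mem
  refine @IsSimpleOrder.mk _ _ _ ⟨⊥, ⊤, fun hbt => ?_⟩ fun R => ?_
  · obtain ⟨u, hu⟩ := hnt
    have : u ∈ (⊥ : Subrepresentation P.toRepresentation) := hbt ▸ trivial
    exact hu this
  · let Q : Subrepresentation ρ :=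
      { toSubmodule := R.toSubmodule.map P.toSubmodule.subtype
        apply_mem_toSubmodule := by
          rintro g _ ⟨u, hu, rfl⟩
          exact ⟨_, R.apply_mem_toSubmodule g hu, rfl⟩ }
    have hQ : ∀ u : P.toSubmodule, u.1 ∈ Q ↔ u ∈ R := by
      intro u
      constructor
      · rintro ⟨w, hw, hwu⟩
        exact Subtype.val_injective hwu ▸ hw
      · intro hu
        exact ⟨u, hu, rfl⟩
    have hQP : Q ≤ P := by
      rintro _ ⟨u, -, rfl⟩
      exact u.2
    refine (h Q hQP).imp (fun h0 => ?_) fun h1 => ?_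
    · refine SetLike.ext fun u => ?_
      rw [← hQ, h0]
      exact ⟨fun hu => Subtype.ext hu, fun hu => congrArg Subtype.val hu⟩
    · refine SetLike.ext fun u => ?_
      rw [← hQ, h1]
      exact ⟨fun _ => trivial, fun _ => u.2⟩

variable [FiniteDimensional ℂ V]

/-- Complete reducibility of unitary representations, with orthogonal summands. -/
theorem exists_orthogonal_irreducible (hρ : IsUnitaryRep ρ) (N : ℕ) :
    ∀ P : Subrepresentation ρ, Module.finrank ℂ P.toSubmodule = N →
      ∃ (ι : Type) (_ : Fintype ι) (s : ι → Subrepresentation ρ),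
        (∀ i, (s i).toRepresentation.IsIrreducible) ∧
        (∀ i j, i ≠ j → (s i).toSubmodule ⟂ (s j).toSubmodule) ∧
        ⨆ i, (s i).toSubmodule = P.toSubmodule := by
  induction N using Nat.strong_induction_on with
  | _ N ih =>
    rintro P rfl
    by_cases hP : P = ⊥
    · refine ⟨Empty, inferInstance, Empty.elim, fun i => i.elim, fun i => i.elim, ?_⟩
      rw [iSup_of_empty, hP]
      rfl
    by_cases hirr : ∀ Q : Subrepresentation ρ, Q ≤ P → Q = ⊥ ∨ Q = P
    · exact ⟨Unit, inferInstance, fun _ => P, fun _ => irreducible_of_forall_le P hP hirr,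
        fun i j hij => absurd rfl hij, iSup_const⟩
    push Not at hirr
    obtain ⟨Q, hQP, hQ0, hQ1⟩ := hirr
    have hsup : Q.toSubmodule ⊔ (orthogonalIn hρ P Q).toSubmodule = P.toSubmodule :=
      Submodule.sup_orthogonal_inf_of_hasOrthogonalProjection hQP
    have hlt : ∀ R : Subrepresentation ρ, R ≤ P → R ≠ P →
        Module.finrank ℂ R.toSubmodule < Module.finrank ℂ P.toSubmodule := fun R h1 h2 =>
      Submodule.finrank_lt_finrank_of_lt
        (lt_of_le_of_ne h1 fun h => h2 (Subrepresentation.toSubmodule_injective h))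
    have hle : orthogonalIn hρ P Q ≤ P :=
      inf_le_right (a := Q.toSubmoduleᗮ) (b := P.toSubmodule)
    have hR : orthogonalIn hρ P Q ≠ P := by
      intro h
      refine hQ0 (Subrepresentation.toSubmodule_injective ?_)
      have h1 : Q.toSubmodule ≤ Q.toSubmoduleᗮ := fun v hv => by
        have : v ∈ orthogonalIn hρ P Q := h.symm ▸ hQP hv
        exact this.1
      exact (Submodule.isOrtho_self).mp h1
    obtain ⟨ι₁, _, s₁, hs₁, ho₁, ht₁⟩ := ih _ (hlt Q hQP hQ1) Q rfl
    obtain ⟨ι₂, _, s₂, hs₂, ho₂, ht₂⟩ := ih _ (hlt _ hle hR) (orthogonalIn hρ P Q) rfl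
    have ho : ∀ i j, (s₁ i).toSubmodule ⟂ (s₂ j).toSubmodule := by
      intro i j
      have h1 : (s₁ i).toSubmodule ≤ Q.toSubmodule := ht₁ ▸ le_iSup (fun i => (s₁ i).toSubmodule) i
      have h2 : (s₂ j).toSubmodule ≤ Q.toSubmoduleᗮ :=
        (le_iSup (fun i => (s₂ i).toSubmodule) j).trans (ht₂.le.trans inf_le_left)
      exact (Submodule.isOrtho_orthogonal_right Q.toSubmodule).mono h1 h2
    refine ⟨ι₁ ⊕ ι₂, inferInstance, Sum.elim s₁ s₂, ?_, ?_, ?_⟩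
    · rintro (i | i)
      exacts [hs₁ i, hs₂ i]
    · rintro (i | i) (j | j) hij
      · exact ho₁ i j fun h => hij (h ▸ rfl)
      · exact ho i j
      · exact (ho j i).symm
      · exact ho₂ i j fun h => hij (h ▸ rfl)
    · rw [iSup_sum]
      simp only [Sum.elim_inl, Sum.elim_inr]
      rw [ht₁, ht₂, hsup]

/-- Group the members of an orthogonal decomposition into irreducible subrepresentations by their
isomorphism classes. -/
theorem nonempty_isotypicDecomposition (hρ : IsUnitaryRep ρ) :
    Nonempty (IsotypicDecomposition ρ) := by
  classical
  obtain ⟨ι, _, s, hs, ho, ht⟩ := exists_orthogonal_irreducible hρ _ ⊤ rfl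
  let r : Setoid ι :=
    { r := fun i j => Nonempty ((s i).toRepresentation.Equiv (s j).toRepresentation)
      iseqv := ⟨fun i => ⟨.refl _⟩, fun ⟨e⟩ => ⟨e.symm⟩, fun ⟨e⟩ ⟨f⟩ => ⟨e.trans f⟩⟩ }
  let e := (Fintype.equivFin (Quotient r)).symm
  let F := fun j => {i : ι // (Quotient.mk r i) = e j}
  let f := fun j => (Fintype.equivFin (F j)).symm
  have hpair : ∀ {j j' a a'}, (f j a).1 = (f j' a').1 → j = j' := fun {j j' a a'} h =>
    e.injective ((f j a).2.symm.trans ((congrArg _ h).trans (f j' a').2))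
  have hortho : Pairwise fun j j' =>
      (⨆ a, (s (f j a).1).toSubmodule) ⟂ ⨆ a, (s (f j' a).1).toSubmodule := by
    intro j j' hj
    rw [Submodule.isOrtho_iSup_left]
    intro a
    rw [Submodule.isOrtho_iSup_right]
    exact fun a' => ho _ _ fun h => hj (hpair h)
  refine ⟨⟨Fintype.card (Quotient r), fun j => ⨆ a, (s (f j a).1).toSubmodule,
    fun j => Fintype.card (F j), fun j => ?_, fun j a => s (f j a).1, fun j a => hs _, ?_, ?_,
    fun j => rfl, ?_⟩⟩
  · obtain ⟨i, hi⟩ := Quotient.exists_rep (e j)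
    exact Fintype.card_pos_iff.mpr ⟨⟨i, hi⟩⟩
  · intro j a j' a'
    have h1 : Nonempty ((s (f j a).1).toRepresentation.Equiv (s (f j' a').1).toRepresentation) ↔
        Quotient.mk r (f j a).1 = Quotient.mk r (f j' a').1 := (Quotient.eq (r := r)).symm
    rw [h1, (f j a).2, (f j' a').2, e.injective.eq_iff]
  · intro j
    refine (OrthogonalFamily.of_pairwise fun a a' ha => ?_).independent
    exact ho _ _ fun h => ha ((f j).injective (Subtype.ext h))
  · rw [(OrthogonalFamily.of_pairwise hortho).isInternal_iff]
    have : ⨆ j, ⨆ a, (s (f j a).1).toSubmodule = ⊤ := by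
      rw [eq_top_iff]
      refine ht.ge.trans (iSup_le fun i => ?_)
      let j := e.symm (Quotient.mk r i)
      let a := (f j).symm ⟨i, (e.apply_symm_apply _).symm⟩
      have hi : (f j a).1 = i := by simp [a]
      calc (s i).toSubmodule = (s (f j a).1).toSubmodule := by rw [hi]
        _ ≤ ⨆ a, (s (f j a).1).toSubmodule := le_iSup (fun a => (s (f j a).1).toSubmodule) a
        _ ≤ _ := le_iSup (fun j => ⨆ a, (s (f j a).1).toSubmodule) j
    rw [this, Submodule.top_orthogonal_eq_bot]

end Existence

/-! ### The Toeplitz algebra as a commutant -/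

variable {n m : ℕ}

theorem isUnitaryRep_bergmanRepRestrict (m : ℕ) (K : Subgroup (Matrix.unitaryGroup (Fin n) ℂ)) :
    IsUnitaryRep (bergmanRepRestrict m K) :=
  fun k f g => inner_bergmanRep k.1 f g

theorem toeplitzAlgebra_eq_commutant (m : ℕ) (K : Subgroup (Matrix.unitaryGroup (Fin n) ℂ)) :
    toeplitzAlgebra m (invariantSymbols K) = commutant (bergmanRepRestrict m K) := by
  have hρ := isUnitaryRep_bergmanRepRestrict m K
  refine le_antisymm ?_ fun X hX => ?_
  · -- A finite-dimensional subspace is closed, so the norm closure stays inside the commutant.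
    refine StarSubalgebra.topologicalClosure_minimal (StarAlgebra.adjoin_le ?_) ?_
    · rintro _ ⟨a, ha, rfl⟩
      exact (mem_commutant hρ).mpr fun k f => toeplitz_commute ha k.2 f
    · exact Submodule.closed_of_finiteDimensional
        (Subalgebra.toSubmodule (commutant (bergmanRepRestrict m K)).toSubalgebra)
  · obtain ⟨a, ha, rfl⟩ := exists_toeplitz_eq (K := K) fun k hk f =>
      (mem_commutant hρ).mp hX ⟨k, hk⟩ f
    exact StarSubalgebra.le_topologicalClosure _ (StarAlgebra.subset_adjoin ℂ _ ⟨a, ha, rfl⟩)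

end ProjBergman

theorem theorem3p4 (n m : ℕ) (K : Subgroup (Matrix.unitaryGroup (Fin n) ℂ))
    (hK : IsClosed (K : Set (Matrix.unitaryGroup (Fin n) ℂ))) :
    Nonempty (ProjBergman.IsotypicDecomposition (ProjBergman.bergmanRepRestrict m K)) ∧
    ∀ d : ProjBergman.IsotypicDecomposition (ProjBergman.bergmanRepRestrict m K),
      (∃ φ : ProjBergman.toeplitzAlgebra m (ProjBergman.invariantSymbols K) ≃⋆ₐ[ℂ]
          ((j : Fin d.numComponents) → Matrix (Fin (d.mult j)) (Fin (d.mult j)) ℂ),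
        Isometry φ) ∧
      ((∀ S T : ProjBergman.toeplitzAlgebra m (ProjBergman.invariantSymbols K), S * T = T * S) ↔
        ∀ j, d.mult j = 1) := by
  have hρ := ProjBergman.isUnitaryRep_bergmanRepRestrict m K
  refine ⟨ProjBergman.nonempty_isotypicDecomposition hρ, fun d => ?_⟩
  -- Closedness makes the algebra a C*-algebra, as the isometry property below requires.
  have hclosed : IsClosed (ProjBergman.toeplitzAlgebra m (ProjBergman.invariantSymbols K) :
      Set (ProjBergman.BergmanSpace n m →L[ℂ] ProjBergman.BergmanSpace n m)) :=
    isClosed_closure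
  obtain ⟨φ⟩ : Nonempty (ProjBergman.toeplitzAlgebra m (ProjBergman.invariantSymbols K) ≃⋆ₐ[ℂ]
      ((j : Fin d.numComponents) → Matrix (Fin (d.mult j)) (Fin (d.mult j)) ℂ)) := by
    rw [ProjBergman.toeplitzAlgebra_eq_commutant]
    obtain ⟨e, hsame, hne⟩ := d.exists_matrixUnits hρ
    exact ⟨e.starAlgEquiv hsame hne⟩
  refine ⟨⟨φ, StarAlgEquiv.isometry φ⟩, ?_⟩
  rw [← ProjBergman.pi_matrix_commute_iff d.mult d.mult_pos]
  constructor
  · intro h M N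
    simpa using congrArg φ (h (φ.symm M) (φ.symm N))
  · intro h S T
    exact φ.injective (by rw [map_mul, map_mul, h])
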